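/- Let $p$ be a prime, $n\ge 1$, let $\mathcal A_{n,p}=\bigoplus_{\mathbb Z}(\mathbb Z/p\mathbb Z)^n$ with the shift automorphism $(x\omega)_i=\omega_{i+1}$, and let $\mathcal L_{n,p}=(\mathbb Z/p\mathbb Z)^n\wr\mathbb Z=\mathcal A_{n,p}\rtimes\mathbb Z$ be the lamplighter group, with $(v,s)(w,t)=(v+x^sw,s+t)$. For a countable group $G$ let $\mathrm{Sub}(G)$ be the compact space of subgroups of $G$ with the topology induced from $\{0,1\}^G$. Borel probability measures on $\mathrm{Sub}(G)$ are viewed as elements of the dual of $C(\mathrm{Sub}(G))$ with the weak* topology. Let $\mathrm{IRS}(G)$ be the set of conjugation-invariant Borel probability measures on $\mathrm{Sub}(G)$, and $\mathrm{IRS}_*(G)$ the set of those giving full measure to the perfect kernel of $\mathrm{Sub}(G)$ (its largest perfect subset). Let $\mathrm{IRS}_0(\mathcal L_{n,p})$ be the set of $\mu\in\mathrm{IRS}(\mathcal L_{n,p})$ giving full measure to the subgroups with trivial projection to $\mathbb Z$. Let $\mathrm{IRS}_\tau(\mathcal A_{n,p})$ be the set of Borel probability measures on $\mathrm{Sub}(\mathcal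 A_{n,p})$ invariant under the shift action $\tau(H)=xH$. A simplex is a compact convex metrizable subset $K$ of a Hausdorff locally convex space such that every point of $K$ is the barycenter of a unique Borel probability measure supported on the extreme points of $K$. A Poulsen simplex is a simplex with more than one point whose extreme points are dense in it. 1. $\mathrm{IRS}_\tau(\mathcal A_{n,p})$ is a Poulsen simplex, and its extreme points are exactly the ergodic measures in it. Moreover, let $\mu\in\mathrm{IRS}_\tau(\mathcal A_{n,p})$ and, for $m\ge1$, let $\mathcal X_m\le\mathcal A_{n,p}$ be the subgroup of the elements supported in $\{0,\dots,m-1\}$, let $(H_k)_{k\in\mathbb Z}$ be independent random subgroups of $\mathcal X_m$, each with the law of $H\cap\mathcal X_m$ for $H$ of law $\mu$, let $\beta_m$ be the law of $\bigoplus_{k\in\mathbb Z}x^{km}H_k$, and let $\mu_m=\frac1m\sum_{k=0}^{m-1}\tau^k_*\beta_m$. Then every $\mu_m$ is a $\tau$-invariant ergodic probability measure, and $\mu_m\to\mu$ in the weak* topology as $m\to\infty$. 2. $\mathrm{IRS}_0(\mathcal L_{n,p})=\mathrm{IRS}_*(\mathcal L_{n,p})$, and this is a Poulsen simplex, whose extreme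 points are exactly the measures in it that are ergodic for the conjugation action of $\mathcal L_{n,p}$. -/

import Mathlib

open MeasureTheory

noncomputable section

/-! ## Simplices in locally convex spaces -/

/-- A (metrizable, compact) simplex: a convex, compact, metrizable subset `K` of a locally convex
Hausdorff space `E` such that every point `ξ` of `K` is the barycenter of a unique Borel
probability measure supported on the extreme points of `K`.  The barycenter condition
`ξ = ∫ x dm(x)` is meant weakly: `∫ f dm = f ξ` for each continuous linear functional `f`. -/
structure IsSimplex {E : Type*} [AddCommGroup E] [Module ℝ E] [TopologicalSpace E]
    [IsTopologicalAddGroup E] [ContinuousSMul ℝ E] [LocallyConvexSpace ℝ E] [T2Space E]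
    [MeasurableSpace E] [BorelSpace E] (K : Set E) : Prop where
  convex : Convex ℝ K
  isCompact : IsCompact K
  metrizable : TopologicalSpace.MetrizableSpace K
  existsUnique_representing : ∀ ξ ∈ K, ∃! m : ProbabilityMeasure E,
    (∀ᵐ x ∂(m : Measure E), x ∈ K.extremePoints ℝ) ∧
      ∀ f : StrongDual ℝ E, ∫ x, f x ∂(m : Measure E) = f ξ

/-- A Poulsen simplex: a simplex with more than one point whose extreme points are dense in it.
(The degenerate one-point simplex, for which density is void, is not counted.) -/
structure IsPoulsenSimplex {E : Type*} [AddCommGroup E] [Module ℝ E] [TopologicalSpace E]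
    [IsTopologicalAddGroup E] [ContinuousSMul ℝ E] [LocallyConvexSpace ℝ E] [T2Space E]
    [MeasurableSpace E] [BorelSpace E] (K : Set E) : Prop extends IsSimplex K where
  nontrivial : K.Nontrivial
  dense_extremePoints : K ⊆ closure (K.extremePoints ℝ)

/-! ## The space of subgroups -/

section Subgroups

variable {G : Type*} [Group G]

open scoped Classical in
/-- The characteristic function of a subgroup, as an element of `{0,1}^G`. -/
def Subgroup.charFun (H : Subgroup G) : G → Bool := fun g => decide (g ∈ H)

/-- The topology of `Sub(G)`, induced from the product topology on `{0,1}^G`. -/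
instance Subgroup.instTopologicalSpaceSub : TopologicalSpace (Subgroup G) :=
  TopologicalSpace.induced Subgroup.charFun inferInstance

/-- The Borel sigma-algebra of `Sub(G)`. -/
instance Subgroup.instMeasurableSpaceSub : MeasurableSpace (Subgroup G) := borel _

instance Subgroup.instBorelSpaceSub : BorelSpace (Subgroup G) := ⟨rfl⟩

theorem Subgroup.isClosed_range_charFun :
    IsClosed (Set.range (Subgroup.charFun : Subgroup G → G → Bool)) := by
  have h : Set.range (Subgroup.charFun : Subgroup G → G → Bool) =
      {f | f 1 = true} ∩ (⋂ a, ⋂ b, {f | (f a && f b && !(f (a * b))) = false}) ∩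
        (⋂ a, {f | (f a && !(f a⁻¹)) = false}) := by
    ext f
    constructor
    · rintro ⟨H, rfl⟩
      simp only [Set.mem_inter_iff, Set.mem_iInter, Set.mem_ofPred_eq, Subgroup.charFun]
      refine ⟨⟨by simp [H.one_mem], fun a b => ?_⟩, fun a => ?_⟩
      · by_cases ha : a ∈ H <;> by_cases hb : b ∈ H <;> simp [ha, hb, H.mul_mem]
      · by_cases ha : a ∈ H <;> simp [ha]
    · rintro ⟨⟨h1, h2⟩, h3⟩
      simp only [Set.mem_iInter, Set.mem_ofPred_eq] at h1 h2 h3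
      refine ⟨{ carrier := {g | f g = true}, one_mem' := h1, mul_mem' := ?_, inv_mem' := ?_ }, ?_⟩
      · intro a b ha hb
        have := h2 a b
        simp only [Set.mem_ofPred_eq] at ha hb ⊢
        simpa [ha, hb] using this
      · intro a ha
        have := h3 a
        simp only [Set.mem_ofPred_eq] at ha ⊢
        simpa [ha] using this
      · funext g
        simp only [Subgroup.charFun]
        by_cases hg : f g = true
        · simp [← SetLike.mem_coe, hg]
        · simp [← SetLike.mem_coe, hg]
  rw [h]
  refine ((isClosed_eq (by fun_prop) (by fun_prop)).inter ?_).inter ?_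
  · refine isClosed_iInter fun a => isClosed_iInter fun b => ?_
    exact isClosed_eq ((continuous_of_discreteTopology
      (f := fun x : Bool × Bool × Bool => (x.1 && x.2.1 && !x.2.2))).comp
      (g := fun x : Bool × Bool × Bool => (x.1 && x.2.1 && !x.2.2))
      (f := fun f : G → Bool => (f a, f b, f (a * b))) (by fun_prop)) continuous_const
  · refine isClosed_iInter fun a => ?_
    exact isClosed_eq ((continuous_of_discreteTopology
      (f := fun x : Bool × Bool => (x.1 && !x.2))).comp
      (g := fun x : Bool × Bool => (x.1 && !x.2))
      (f := fun f : G → Bool => (f a, f a⁻¹)) (by fun_prop)) continuous_const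

instance Subgroup.instCompactSpaceSub : CompactSpace (Subgroup G) :=
  (Topology.IsInducing.mk rfl : Topology.IsInducing
    (Subgroup.charFun : Subgroup G → G → Bool)).isCompact_iff.mpr
      (by simpa using Subgroup.isClosed_range_charFun.isCompact) |> fun h => ⟨h⟩

end Subgroups

/-! ## Probability measures as elements of the weak-* dual of the continuous functions -/

section Dual

variable {X : Type*} [TopologicalSpace X]

/-- The Borel sigma-algebra of the weak-* dual of `C(X)`. -/
instance WeakDual.instMeasurableSpaceCont : MeasurableSpace (WeakDual ℝ C(X, ℝ)) := borel _

instance WeakDual.instBorelSpaceCont : BorelSpace (WeakDual ℝ C(X, ℝ)) := ⟨rfl⟩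

instance WeakDual.instLocallyConvexSpaceCont : LocallyConvexSpace ℝ (WeakDual ℝ C(X, ℝ)) :=
  WeakBilin.locallyConvexSpace (B := topDualPairing ℝ C(X, ℝ))

variable [CompactSpace X] [MeasurableSpace X] [BorelSpace X]

/-- A Borel probability measure `μ` on a compact space `X`, viewed as the functional
`f ↦ ∫ f dμ` in the Banach dual of `C(X)` with the weak-* topology. -/
def measureToDual (μ : ProbabilityMeasure X) : WeakDual ℝ C(X, ℝ) :=
  StrongDual.toWeakDual <| LinearMap.mkContinuous
    { toFun := fun f : C(X, ℝ) => ∫ x, f x ∂(μ : Measure X)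
      map_add' := fun f g => integral_add
        (f.continuous.integrable_of_hasCompactSupport (HasCompactSupport.of_compactSpace _))
        (g.continuous.integrable_of_hasCompactSupport (HasCompactSupport.of_compactSpace _))
      map_smul' := fun c f => integral_const_mul c _ }
    1 (fun f => by
      simpa using norm_integral_le_of_norm_le_const (μ := (μ : Measure X))
        (Filter.Eventually.of_forall fun x => f.norm_coe_le_norm x))

end Dual

/-! ## Lamplighter groups and invariant random subgroups -/

namespace Lamplighter

/-- The group `A_{n,p} = ⊕_ℤ (ℤ/pℤ)^n` (written multiplicatively). -/
abbrev LampGroup (n p : ℕ) : Type := Multiplicative (ℤ →₀ (Fin n → ZMod p))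

/-- The shift `ω ↦ xω` of `A_{n,p}`, `(xω)_i = ω_{i+1}`. -/
def shift (n p : ℕ) : MulAut (LampGroup n p) :=
  AddEquiv.toMultiplicative (Finsupp.domCongr (Equiv.subRight (1 : ℤ)))

theorem shift_apply (n p : ℕ) (ω : LampGroup n p) (i : ℤ) :
    (shift n p ω).toAdd i = ω.toAdd (i + 1) := rfl

/-- The lamplighter group `L_{n,p} = (ℤ/pℤ)^n ≀ ℤ = A_{n,p} ⋊ ℤ`, where `s : ℤ` acts on `A_{n,p}`
by the `s`-th power of the shift: `(v, s)(w, t) = (v + x^s w, s + t)`. -/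
abbrev LamplighterGroup (n p : ℕ) : Type :=
  SemidirectProduct (LampGroup n p) (Multiplicative ℤ) (zpowersHom (MulAut (LampGroup n p))
    (shift n p))

theorem lamplighter_mul (n p : ℕ) (v w : LampGroup n p) (s t : ℤ) :
    (⟨v, .ofAdd s⟩ * ⟨w, .ofAdd t⟩ : LamplighterGroup n p) =
      ⟨v * (shift n p ^ s) w, .ofAdd (s + t)⟩ := rfl

/-- The action `τ` of the shift on `Sub(A_{n,p})`. -/
def shiftSub (n p : ℕ) (H : Subgroup (LampGroup n p)) : Subgroup (LampGroup n p) :=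
  H.map (shift n p).toMonoidHom

/-- `IRS_τ(A_{n,p})`: the shift-invariant Borel probability measures on `Sub(A_{n,p})`. -/
def shiftIRS (n p : ℕ) : Set (ProbabilityMeasure (Subgroup (LampGroup n p))) :=
  {μ | MeasurePreserving (shiftSub n p) (μ : Measure (Subgroup (LampGroup n p))) μ}

section IRS

open scoped Pointwise

/-- `IRS(G)`: the Borel probability measures on `Sub(G)` invariant under conjugation. -/
def IRS (G : Type*) [Group G] : Set (ProbabilityMeasure (Subgroup G)) :=
  {μ | SMulInvariantMeasure (ConjAct G) (Subgroup G) (μ : Measure (Subgroup G))}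

/-- A measure on `Sub(G)` is ergodic for the conjugation action of `G`. -/
def IsConjErgodic {G : Type*} [Group G] (μ : ProbabilityMeasure (Subgroup G)) : Prop :=
  ErgodicSMul (ConjAct G) (Subgroup G) (μ : Measure (Subgroup G))

end IRS

/-- `IRS_*(G)`: the invariant random subgroups supported on the perfect kernel of `Sub(G)`. -/
def IRSStar (G : Type*) [Group G] : Set (ProbabilityMeasure (Subgroup G)) :=
  {μ ∈ IRS G | (μ : Measure (Subgroup G))
    (CantorBendixson.perfectKernel (Set.univ : Set (Subgroup G))) = 1}

/-- `IRS_s(L_{n,p})`: the invariant random subgroups giving full measure to the set of all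
subgroups `V` whose projection to `ℤ` is `sℤ`. -/
def IRSLevel (n p s : ℕ) : Set (ProbabilityMeasure (Subgroup (LamplighterGroup n p))) :=
  {μ ∈ IRS (LamplighterGroup n p) | (μ : Measure (Subgroup (LamplighterGroup n p)))
    {V | V.map SemidirectProduct.rightHom =
      Subgroup.zpowers (Multiplicative.ofAdd (s : ℤ))} = 1}

/-! ## Blockwise Bernoulli measures -/

/-- `X^{[i,j)}`: the subgroup of all `w` in `A_{n,p}` with `w_k = 0` unless `i ≤ k < j`. -/
def block (n p : ℕ) (i j : ℤ) : Subgroup (LampGroup n p) where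
  carrier := {w | ∀ k : ℤ, k ∉ Set.Ico i j → w.toAdd k = 0}
  one_mem' := fun _ _ => rfl
  mul_mem' := fun {a b} ha hb k hk => by
    have h : (a * b).toAdd k = a.toAdd k + b.toAdd k := rfl
    rw [h, ha k hk, hb k hk, add_zero]
  inv_mem' := fun {a} ha k hk => by
    have h : (a⁻¹).toAdd k = -a.toAdd k := rfl
    rw [h, ha k hk, neg_zero]

/-- The map `(H_k)_k ↦ ⊕_k x^{km} H_k` from `Sub(X^{[0,m)})^ℤ` to `Sub(A_{n,p})`. -/
def blockSum (n p m : ℕ) (H : ℤ → Subgroup (block n p 0 m)) : Subgroup (LampGroup n p) :=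
  ⨆ k : ℤ, ((H k).map (block n p 0 m).subtype).map (shift n p ^ (k * (m : ℤ))).toMonoidHom

/-- The law of `⊕_k x^{km} H_k`, where the `H_k` are independent and each one has the law of
`H ∩ X^{[0,m)}` for `H` of law `μ`. -/
def blockBernoulli (n p m : ℕ) (μ : Measure (Subgroup (LampGroup n p))) :
    Measure (Subgroup (LampGroup n p)) :=
  (Measure.infinitePi fun _ : ℤ =>
    μ.map fun H => H.subgroupOf (block n p 0 m)).map (blockSum n p m)

/-- The average `(1/m) ∑_{k<m} τ^k` of the blockwise Bernoulli measure over the shift. -/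
def blockAverage (n p m : ℕ) (μ : Measure (Subgroup (LampGroup n p))) :
    Measure (Subgroup (LampGroup n p)) :=
  (m : ENNReal)⁻¹ • ∑ k ∈ Finset.range m, (blockBernoulli n p m μ).map (shiftSub n p)^[k]

end Lamplighter

end

/-! Simplex. For a continuous map `T` of a compact metrizable space, the invariant probability
measures are convex and weak* compact, with the ergodic ones as extreme points. A representing
measure of `μ` (`exists_ergodicDecomposition`) is a limit `m` of the laws of the empirical measures
of orbit segments started at a `μ`-random point. Birkhoff averages preserve the integral, so `m` has
barycenter `μ`; telescoping makes `m`-almost every point invariant; and the variances of the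
Birkhoff averages have `m`-integrals tending to 0, which forces ergodicity. Neither the pointwise
ergodic theorem nor disintegration is used. For uniqueness (`eq_of_forall_integral_evalProb_eq`),
consider the continuous functions `g` on the state space whose value at each ergodic `ν` is the
`L¹(ν)` limit of one bounded sequence `F n` of continuous functions. They form an algebra containing
the evaluations (mean ergodic theorem), hence dense by Stone–Weierstrass, and `∫ g dm = lim ∫ φ(F n)
dm(φ)` depends only on the barycenter.

Density. The law of the independent block sum is a factor of a Bernoulli shift, the shift
corresponding to `τ^m`; so it is `τ^m`-ergodic and its average over a period is `τ`-ergodic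
(`ergodic_blockAverage`). For an event about finitely many elements supported in `[-R, R)`, the
`k`-th translate gives the same probability as `μ` as soon as the window moved by `k` fits in one
block. At most `2R` of the `m` values of `k` fail, so the error is at most `2R/m`
(`abs_blockAverage_agreeSet_sub_le`).

Lamplighter group. A subgroup not contained in the base is finitely generated, because Laurent
polynomials over `ℤ` are Noetherian; there are countably many of these, while the subgroups of the
base form a perfect set, which is therefore the perfect kernel (`perfectKernel_univ_eq`). The base
is abelian, so conjugation acts on its subgroups through powers of the shift. Everything then
transfers along the injective push-forward from `Sub(A)`. -/

noncomputable section

/-! ### Invariant measures in the weak* dual, and their extreme points. -/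

section Dual

open Filter Topology

/-- The set of invariant Borel probability measures of a map. -/
def invariantMeasures {X : Type*} [MeasurableSpace X] (T : X → X) : Set (ProbabilityMeasure X) :=
  {μ | MeasurePreserving T (μ : Measure X) μ}

theorem invariantMeasures_id {X : Type*} [MeasurableSpace X] :
    invariantMeasures (id : X → X) = Set.univ :=
  Set.eq_univ_of_forall fun _ => MeasurePreserving.id _

theorem WeakDual.exists_eval_eq {X : Type*} [TopologicalSpace X]
    (F : StrongDual ℝ (WeakDual ℝ C(X, ℝ))) :
    ∃ f : C(X, ℝ), ∀ φ, F φ = φ f := by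
  obtain ⟨f, rfl⟩ := LinearMap.dualEmbedding_surjective (topDualPairing ℝ C(X, ℝ)) F
  exact ⟨f, fun φ => rfl⟩

theorem MeasureTheory.Measure.ext_of_forall_integral_continuousMap_eq {X : Type*}
    [TopologicalSpace X] [TopologicalSpace.MetrizableSpace X] [MeasurableSpace X] [BorelSpace X]
    {μ ν : Measure X} [IsFiniteMeasure μ] [IsFiniteMeasure ν]
    (h : ∀ f : C(X, ℝ), ∫ x, f x ∂μ = ∫ x, f x ∂ν) : μ = ν :=
  letI := TopologicalSpace.metrizableSpaceMetric X
  ext_of_forall_integral_eq_of_IsFiniteMeasure fun f => h f.toContinuousMap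

theorem measurePreserving_iff_forall_integral {X : Type*} [TopologicalSpace X]
    [TopologicalSpace.MetrizableSpace X] [MeasurableSpace X] [BorelSpace X] {T : X → X}
    (hT : Continuous T) {μ : Measure X}
    [IsProbabilityMeasure μ] :
    MeasurePreserving T μ μ ↔ ∀ f : C(X, ℝ), ∫ x, f (T x) ∂μ = ∫ x, f x ∂μ := by
  have key (f : C(X, ℝ)) : ∫ x, f x ∂(μ.map T) = ∫ x, f (T x) ∂μ :=
    integral_map hT.measurable.aemeasurable f.continuous.aestronglyMeasurable
  have := Measure.isProbabilityMeasure_map (μ := μ) hT.measurable.aemeasurable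
  refine ⟨fun h f => ?_, fun h => ⟨hT.measurable, ?_⟩⟩
  · rw [← key, h.map_eq]
  · exact Measure.ext_of_forall_integral_continuousMap_eq fun f => by rw [key, h]

variable {X : Type*} [TopologicalSpace X] [CompactSpace X] [MeasurableSpace X] [BorelSpace X]

theorem measureToDual_apply (μ : ProbabilityMeasure X) (f : C(X, ℝ)) :
    measureToDual μ f = ∫ x, f x ∂(μ : Measure X) := rfl

theorem ContinuousMap.integrable_of_compactSpace (f : C(X, ℝ)) (μ : Measure X)
    [IsFiniteMeasure μ] : Integrable f μ :=
  f.continuous.integrable_of_hasCompactSupport (HasCompactSupport.of_compactSpace _)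

theorem continuous_measureToDual :
    Continuous (measureToDual : ProbabilityMeasure X → WeakDual ℝ C(X, ℝ)) := by
  refine WeakDual.continuous_of_continuous_eval fun f => ?_
  rw [continuous_iff_continuousAt]
  intro μ
  exact (ProbabilityMeasure.tendsto_iff_forall_integral_tendsto.mp tendsto_id)
    (BoundedContinuousFunction.mkOfCompact f)

theorem exists_convexCombination (μ ν : ProbabilityMeasure X) {a b : ℝ} (ha : 0 ≤ a) (hb : 0 ≤ b)
    (hab : a + b = 1) : ∃ ρ : ProbabilityMeasure X,
      (ρ : Measure X) = ENNReal.ofReal a • (μ : Measure X) + ENNReal.ofReal b • (ν : Measure X) ∧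
      measureToDual ρ = a • measureToDual μ + b • measureToDual ν := by
  refine ⟨⟨ENNReal.ofReal a • (μ : Measure X) + ENNReal.ofReal b • (ν : Measure X), ⟨?_⟩⟩, rfl, ?_⟩
  · simp [← ENNReal.ofReal_add ha hb, hab]
  · refine DFunLike.ext _ _ fun f => ?_
    change ∫ x, f x ∂(ENNReal.ofReal a • (μ : Measure X) + ENNReal.ofReal b • (ν : Measure X)) =
      a * ∫ x, f x ∂(μ : Measure X) + b * ∫ x, f x ∂(ν : Measure X)
    rw [integral_add_measure, integral_smul_measure, integral_smul_measure]
    · simp [ENNReal.toReal_ofReal, ha, hb]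
    · exact (f.integrable_of_compactSpace _).smul_measure (by simp)
    · exact (f.integrable_of_compactSpace _).smul_measure (by simp)

theorem convex_invariantMeasures (T : X → X) : Convex ℝ (measureToDual '' invariantMeasures T) := by
  rintro _ ⟨μ, hμ, rfl⟩ _ ⟨ν, hν, rfl⟩ a b ha hb hab
  obtain ⟨ρ, hρ, h⟩ := exists_convexCombination μ ν ha hb hab
  refine ⟨ρ, ?_, h⟩
  have h1 : MeasurePreserving T (μ : Measure X) μ := hμ
  have h2 : MeasurePreserving T (ν : Measure X) ν := hν
  change MeasurePreserving T (ρ : Measure X) ρ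
  rw [hρ]
  exact ⟨h1.measurable, by rw [Measure.map_add _ _ h1.measurable, Measure.map_smul,
    Measure.map_smul, h1.map_eq, h2.map_eq]⟩

theorem convex_range_measureToDual :
    Convex ℝ (Set.range (measureToDual : ProbabilityMeasure X → _)) := by
  simpa [invariantMeasures_id] using convex_invariantMeasures (id : X → X)

variable [TopologicalSpace.MetrizableSpace X]

theorem measureToDual_injective :
    Function.Injective (measureToDual : ProbabilityMeasure X → WeakDual ℝ C(X, ℝ)) := by
  intro μ ν h
  apply Subtype.ext
  change (μ : Measure X) = ν
  refine Measure.ext_of_forall_integral_continuousMap_eq fun f => ?_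
  rw [← measureToDual_apply, h, measureToDual_apply]

theorem isClosedEmbedding_measureToDual :
    IsClosedEmbedding (measureToDual : ProbabilityMeasure X → WeakDual ℝ C(X, ℝ)) :=
  continuous_measureToDual.isClosedEmbedding measureToDual_injective

/-- The space of Borel probability measures, as a subset of the weak-* dual. -/
abbrev stateSpace (X : Type*) [TopologicalSpace X] [CompactSpace X] [MeasurableSpace X]
    [BorelSpace X] : Set (WeakDual ℝ C(X, ℝ)) := Set.range measureToDual

instance stateSpace.instCompactSpace : CompactSpace (stateSpace X) :=
  isCompact_iff_compactSpace.mp (isCompact_range continuous_measureToDual)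

instance stateSpace.instMetrizableSpace : TopologicalSpace.MetrizableSpace
    (stateSpace X) :=
  isClosedEmbedding_measureToDual.isEmbedding.toHomeomorph.symm.isEmbedding.metrizableSpace

theorem isClosed_invariantMeasures {T : X → X} (hT : Continuous T) :
    IsClosed (invariantMeasures T) := by
  have : invariantMeasures T = ⋂ f : C(X, ℝ),
      {μ | measureToDual μ (f.comp ⟨T, hT⟩) = measureToDual μ f} := by
    ext μ
    simp only [invariantMeasures, Set.mem_ofPred_eq, Set.mem_iInter,
      measurePreserving_iff_forall_integral hT]
    rfl
  rw [this]
  exact isClosed_iInter fun f => isClosed_eq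
    ((WeakDual.eval_continuous _).comp continuous_measureToDual)
    ((WeakDual.eval_continuous _).comp continuous_measureToDual)

theorem isCompact_image_invariantMeasures {T : X → X} (hT : Continuous T) :
    IsCompact (measureToDual '' invariantMeasures T) :=
  (isClosed_invariantMeasures hT).isCompact.image continuous_measureToDual

theorem metrizableSpace_image_measureToDual (S : Set (ProbabilityMeasure X)) :
    TopologicalSpace.MetrizableSpace (measureToDual '' S) :=
  (Topology.IsEmbedding.inclusion (Set.image_subset_range measureToDual S)).metrizableSpace

/-- Ergodicity is already known to be extremality among invariant probability measures with
`ENNReal` coefficients. Weights summing to 1 are finite, so such segments match real segments in the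
dual, and `measureToDual` is injective. -/
theorem extremePoints_image_invariantMeasures (T : X → X) :
    (measureToDual '' invariantMeasures T).extremePoints ℝ =
      measureToDual '' {μ ∈ invariantMeasures T | Ergodic T (μ : Measure X)} := by
  ext φ
  constructor
  · rintro ⟨⟨μ, hμ, rfl⟩, hext⟩
    refine ⟨μ, ⟨hμ, ?_⟩, rfl⟩
    refine Ergodic.of_mem_extremePoints ⟨⟨hμ, inferInstance⟩, ?_⟩
    rintro ν₁ ⟨h₁, p₁⟩ ν₂ ⟨h₂, p₂⟩ ⟨a, b, ha, hb, hab, he⟩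
    have ha' : a ≠ ⊤ := fun h => by simp [h] at hab
    have hb' : b ≠ ⊤ := fun h => by simp [h] at hab
    have hab' : a.toReal + b.toReal = 1 := by
      rw [← ENNReal.toReal_add ha' hb', hab, ENNReal.toReal_one]
    obtain ⟨ρ, hρ, h⟩ := exists_convexCombination ⟨ν₁, p₁⟩ ⟨ν₂, p₂⟩ ENNReal.toReal_nonneg
      ENNReal.toReal_nonneg hab'
    have hρμ : ρ = μ := by
      apply Subtype.ext
      change (ρ : Measure X) = μ
      rw [hρ, ENNReal.ofReal_toReal ha', ENNReal.ofReal_toReal hb', ← he]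
      rfl
    have := hext (x₁ := measureToDual ⟨ν₁, p₁⟩) ⟨_, h₁, rfl⟩ (x₂ := measureToDual ⟨ν₂, p₂⟩)
      ⟨_, h₂, rfl⟩ ⟨a.toReal, b.toReal, ENNReal.toReal_pos ha.ne' ha', ENNReal.toReal_pos hb.ne' hb',
        hab', by rw [← h, hρμ]⟩
    exact congrArg Subtype.val (measureToDual_injective this)
  · rintro ⟨μ, ⟨hμ, he⟩, rfl⟩
    refine ⟨⟨μ, hμ, rfl⟩, ?_⟩
    rintro _ ⟨ν₁, h₁, rfl⟩ _ ⟨ν₂, h₂, rfl⟩ ⟨a, b, ha, hb, hab, h⟩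
    obtain ⟨ρ, hρ, h'⟩ := exists_convexCombination ν₁ ν₂ ha.le hb.le hab
    have hρμ : ρ = μ := measureToDual_injective (h'.trans h)
    have := he.mem_extremePoints.2 (x₁ := (ν₁ : Measure X)) ⟨h₁, inferInstance⟩
      (x₂ := (ν₂ : Measure X)) ⟨h₂, inferInstance⟩ ⟨ENNReal.ofReal a, ENNReal.ofReal b, by simpa, by simpa,
        by rw [← ENNReal.ofReal_add ha.le hb.le, hab, ENNReal.ofReal_one], by rw [← hρ, hρμ]⟩
    rw [show ν₁ = μ from Subtype.ext this]

end Dual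

/-! ### Existence of the ergodic decomposition. -/

section ErgodicDecomposition

open Filter Topology

/-- Markov's inequality: the set where every `h n` is at least `1/(k+1)` has measure at most `(k+1)
∫ h n`, for each `n`. Only the infimum over `n` is controlled, so any nontrivial filter will do, in
particular an ultrafilter. -/
theorem ae_forall_exists_lt_of_tendsto_integral {Ω ι : Type*} [MeasurableSpace Ω] {m : Measure Ω}
    [IsFiniteMeasure m] {h : ι → Ω → ℝ} (hi : ∀ n, Integrable (h n) m) (h0 : ∀ n, 0 ≤ᵐ[m] h n)
    {l : Filter ι} [l.NeBot] (hl : Tendsto (fun n => ∫ ω, h n ω ∂m) l (𝓝 0)) :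
    ∀ᵐ ω ∂m, ∀ ε > 0, ∃ n, h n ω < ε := by
  have key (k : ℕ) : ∀ᵐ ω ∂m, ∃ n, h n ω < 1 / ((k : ℝ) + 1) := by
    have hk : (0 : ℝ) < 1 / ((k : ℝ) + 1) := by positivity
    rw [ae_iff]
    have hle (n : ι) : m.real {ω | ¬ ∃ n, h n ω < 1 / ((k : ℝ) + 1)} ≤
        (∫ ω, h n ω ∂m) / (1 / ((k : ℝ) + 1)) := by
      rw [le_div_iff₀ hk, mul_comm]
      refine le_trans ?_ (mul_meas_ge_le_integral_of_nonneg (h0 n) (hi n)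
        (1 / ((k : ℝ) + 1)))
      gcongr
      · exact measure_ne_top _ _
      · exact fun hω => le_of_not_gt fun hlt => hω ⟨n, hlt⟩
    have h0' := ge_of_tendsto (hl.div_const (1 / ((k : ℝ) + 1))) (Eventually.of_forall hle)
    rw [zero_div] at h0'
    exact (measureReal_eq_zero_iff).mp (le_antisymm h0' measureReal_nonneg)
  filter_upwards [ae_all_iff.mpr key] with ω hω ε hε
  obtain ⟨k, hk⟩ := exists_nat_one_div_lt hε
  obtain ⟨n, hn⟩ := hω k
  exact ⟨n, hn.trans hk⟩

/-- The hypothesis makes `B` independent of every event, in particular of itself, so `μ B = μ B * μ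
B`. -/
theorem eventuallyConst_of_restrict_eq_smul {Ω : Type*} [MeasurableSpace Ω] {μ : Measure Ω}
    [IsProbabilityMeasure μ] {B : Set Ω} (hB : MeasurableSet B) (h : μ.restrict B = μ B • μ) :
    EventuallyConst B (ae μ) := by
  have hBB : μ B = μ B * μ B := by
    simpa using congrArg (fun ν => ν B) h
  rw [Filter.eventuallyConst_set']
  by_cases h0 : μ B = 0
  · exact Or.inl (ae_eq_empty.mpr h0)
  · right
    have h1 : μ B = 1 := by
      have h2 : μ B * 1 = μ B * μ B := by rw [mul_one]; exact hBB
      exact ((ENNReal.mul_right_inj h0 (measure_ne_top μ B)).mp h2).symm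
    rw [ae_eq_univ]
    simpa [prob_compl_eq_zero_iff hB] using h1

theorem integral_abs_sub_integral_le {Ω : Type*} [MeasurableSpace Ω] {m : Measure Ω}
    [IsProbabilityMeasure m] {g : Ω → ℝ} (hg : MemLp g 2 m) :
    ∫ ω, |g ω - ∫ ω, g ω ∂m| ∂m ≤ Real.sqrt (∫ ω, g ω ^ 2 ∂m - (∫ ω, g ω ∂m) ^ 2) := by
  set c := ∫ ω, g ω ∂m
  have h2 : MemLp (fun ω => |g ω - c|) 2 m := (hg.sub (memLp_const c)).abs
  have hvar := ProbabilityTheory.variance_nonneg (fun ω => |g ω - c|) m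
  rw [ProbabilityTheory.variance_eq_sub h2] at hvar
  have hvar' := ProbabilityTheory.variance_eq_sub hg
  rw [ProbabilityTheory.variance_eq_integral hg.aemeasurable] at hvar'
  simp only [Pi.pow_apply, sq_abs] at hvar hvar'
  refine Real.le_sqrt_of_sq_le ?_
  linarith

variable {X : Type*} [TopologicalSpace X]

/-- The Birkhoff average of a continuous function, as a continuous function. -/
def birkhoffMap (T : C(X, X)) (N : ℕ) (f : C(X, ℝ)) : C(X, ℝ) where
  toFun := birkhoffAverage ℝ T f N
  continuous_toFun := by
    unfold birkhoffAverage birkhoffSum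
    have := fun k => T.continuous.iterate k
    fun_prop

theorem birkhoffMap_apply (T : C(X, X)) (N : ℕ) (f : C(X, ℝ)) (x : X) :
    birkhoffMap T N f x = (N : ℝ)⁻¹ * ∑ k ∈ Finset.range N, f (T^[k] x) := by
  simp [birkhoffMap, birkhoffAverage, birkhoffSum]

theorem abs_birkhoffMap_comp_sub_le [CompactSpace X] (T : C(X, X)) (N : ℕ) (f : C(X, ℝ)) (x : X) :
    |birkhoffMap T (N + 1) (f.comp T) x - birkhoffMap T (N + 1) f x| ≤
      2 * ‖f‖ * (1 / ((N : ℝ) + 1)) := by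
  have hsum : ∑ k ∈ Finset.range (N + 1), f (T (T^[k] x)) - ∑ k ∈ Finset.range (N + 1), f (T^[k] x) =
      f (T^[N + 1] x) - f x := by
    rw [← Finset.sum_sub_distrib]
    simpa [← Function.iterate_succ_apply'] using
      Finset.sum_range_sub (fun k => f (T^[k] x)) (N + 1)
  have h : birkhoffMap T (N + 1) (f.comp T) x - birkhoffMap T (N + 1) f x =
      (f (T^[N + 1] x) - f x) * (1 / ((N : ℝ) + 1)) := by
    rw [birkhoffMap_apply, birkhoffMap_apply, ← mul_sub, ← hsum]
    simp [mul_comm]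
  rw [h, abs_mul, abs_of_pos (show (0 : ℝ) < 1 / ((N : ℝ) + 1) by positivity)]
  gcongr
  calc |f (T^[N + 1] x) - f x| ≤ |f (T^[N + 1] x)| + |f x| := abs_sub _ _
    _ ≤ ‖f‖ + ‖f‖ := add_le_add (f.norm_coe_le_norm _) (f.norm_coe_le_norm _)
    _ = 2 * ‖f‖ := by ring

variable [CompactSpace X] [MeasurableSpace X] [BorelSpace X]

theorem integral_birkhoffMap {T : C(X, X)} {μ : Measure X} [IsFiniteMeasure μ]
    (hμ : MeasurePreserving T μ μ) {N : ℕ} (hN : N ≠ 0) (f : C(X, ℝ)) :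
    ∫ x, birkhoffMap T N f x ∂μ = ∫ x, f x ∂μ := by
  simp only [birkhoffMap_apply]
  have key (k : ℕ) : ∫ x, f (T^[k] x) ∂μ = ∫ x, f x ∂μ := by
    conv_rhs => rw [← (hμ.iterate k).map_eq]
    exact (integral_map (hμ.iterate k).measurable.aemeasurable
      f.continuous.aestronglyMeasurable).symm
  rw [integral_const_mul, integral_finsetSum]
  · simp [key, hN]
  · exact fun k _ => (f.comp ⟨T^[k], T.continuous.iterate k⟩).integrable_of_compactSpace μ

theorem ContinuousMap.memLp_of_compactSpace (f : C(X, ℝ)) (μ : Measure X) [IsFiniteMeasure μ]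
    (p : ENNReal) : MemLp f p μ :=
  MemLp.of_bound f.continuous.aestronglyMeasurable ‖f‖ (Eventually.of_forall f.norm_coe_le_norm)

theorem continuous_integral_continuousMap (ν : Measure X) [IsFiniteMeasure ν] :
    Continuous fun f : C(X, ℝ) => ∫ x, f x ∂ν := by
  refine (LipschitzWith.of_dist_le_mul (K := ⟨ν.real Set.univ, measureReal_nonneg⟩)
    fun f g => ?_).continuous
  rw [Real.dist_eq, ← integral_sub (f.integrable_of_compactSpace ν)
    (g.integrable_of_compactSpace ν), dist_eq_norm, mul_comm]
  exact norm_integral_le_of_norm_le_const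
    (Eventually.of_forall fun x => (f - g).norm_coe_le_norm x)

variable [TopologicalSpace.MetrizableSpace X]

/-- For an invariant set `B`, replacing `f` by a Birkhoff average changes neither its integral over
`B` nor over `X`. Hence `∫_B f - μ(B) ∫ f` is bounded by the standard deviation of every Birkhoff
average, so it vanishes, and `B` is independent of all continuous functions. -/
theorem ergodic_of_forall_exists_variance_lt {T : C(X, X)} {μ : Measure X}
    [IsProbabilityMeasure μ] (hμ : MeasurePreserving T μ μ) {D : Set C(X, ℝ)} (hD : Dense D)
    (h : ∀ f ∈ D, ∀ ε > 0, ∃ N : ℕ,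
      ∫ x, birkhoffMap T (N + 1) f x ^ 2 ∂μ - (∫ x, f x ∂μ) ^ 2 < ε) : Ergodic T μ := by
  refine ⟨hμ, ⟨fun {B} hB hTB => ?_⟩⟩
  have hBμ : MeasurePreserving T (μ.restrict B) (μ.restrict B) := by
    simpa [hTB] using hμ.restrict_preimage hB
  have hDB : ∀ f ∈ D, ∫ x in B, f x ∂μ = μ.real B * ∫ x, f x ∂μ := by
    intro f hf
    refine eq_of_abs_sub_le_all fun ε hε => ?_
    obtain ⟨N, hN⟩ := h f hf (ε ^ 2) (by positivity)
    set g := birkhoffMap T (N + 1) f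
    have hg : ∫ x, g x ∂μ = ∫ x, f x ∂μ := integral_birkhoffMap hμ (by simp) f
    have hgB : ∫ x in B, g x ∂μ = ∫ x in B, f x ∂μ := integral_birkhoffMap hBμ (by simp) f
    have hgi := g.integrable_of_compactSpace μ
    have e : ∫ x in B, f x ∂μ - μ.real B * ∫ x, f x ∂μ = ∫ x in B, (g x - ∫ x, g x ∂μ) ∂μ := by
      rw [integral_sub hgi.restrict (integrable_const _), hgB, setIntegral_const, hg, smul_eq_mul]
    rw [e]
    calc |∫ x in B, (g x - ∫ x, g x ∂μ) ∂μ| ≤ ∫ x in B, |g x - ∫ x, g x ∂μ| ∂μ :=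
          abs_integral_le_integral_abs
      _ ≤ ∫ x, |g x - ∫ x, g x ∂μ| ∂μ :=
          setIntegral_le_integral (hgi.sub (integrable_const _)).abs
            (Eventually.of_forall fun x => abs_nonneg _)
      _ ≤ Real.sqrt (∫ x, g x ^ 2 ∂μ - (∫ x, g x ∂μ) ^ 2) :=
          integral_abs_sub_integral_le (g.memLp_of_compactSpace μ 2)
      _ ≤ ε := by
          rw [hg]
          exact Real.sqrt_le_iff.mpr ⟨hε.le, hN.le⟩
  have hall : ∀ f : C(X, ℝ), ∫ x in B, f x ∂μ = μ.real B * ∫ x, f x ∂μ := by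
    intro f
    have := (continuous_integral_continuousMap (μ.restrict B)).ext_on hD
      (continuous_const.mul (continuous_integral_continuousMap μ)) hDB
    exact congrFun this f
  have hmeas : μ.restrict B = μ B • μ := by
    have : IsFiniteMeasure (μ B • μ) := Measure.smul_finite _ (measure_ne_top _ _)
    refine Measure.ext_of_forall_integral_continuousMap_eq fun f => ?_
    rw [hall, integral_smul_measure]
    rfl
  exact eventuallyConst_of_restrict_eq_smul hB hmeas

/-- The empirical measure of an orbit segment of length `N + 1`, as a functional. -/
def empiricalFunctional (T : C(X, X)) (N : ℕ) (x : X) :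
    stateSpace X :=
  ⟨∑ k ∈ Finset.range (N + 1), ((N + 1 : ℕ) : ℝ)⁻¹ • measureToDual (diracProba (T^[k] x)),
    convex_range_measureToDual.sum_mem (fun _ _ => by positivity)
      (by simp [mul_inv_cancel₀ (show (N : ℝ) + 1 ≠ 0 by positivity)])
      fun _ _ => Set.mem_range_self _⟩

theorem empiricalFunctional_apply (T : C(X, X)) (N : ℕ) (x : X) (f : C(X, ℝ)) :
    (empiricalFunctional T N x : WeakDual ℝ C(X, ℝ)) f = birkhoffMap T (N + 1) f x := by
  have hsum (s : Finset ℕ) (φ : ℕ → WeakDual ℝ C(X, ℝ)) : (∑ k ∈ s, φ k) f = ∑ k ∈ s, φ k f := by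
    induction s using Finset.cons_induction with
    | empty => rfl
    | cons a s ha ih => rw [Finset.sum_cons, Finset.sum_cons, ← ih]; rfl
  rw [birkhoffMap_apply, Finset.mul_sum, empiricalFunctional, hsum]
  refine Finset.sum_congr rfl fun k _ => ?_
  change _ * measureToDual _ f = _
  rw [measureToDual_apply]
  congr 1
  exact integral_dirac _ _

theorem continuous_empiricalFunctional (T : C(X, X)) (N : ℕ) :
    Continuous (empiricalFunctional T N) := by
  refine Continuous.subtype_mk (WeakDual.continuous_of_continuous_eval fun f => ?_) _
  exact (birkhoffMap T (N + 1) f).continuous.congr fun x =>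
    (empiricalFunctional_apply T N x f).symm

/-- Evaluation at `f`, as a continuous function on the space of probability measures. -/
def evalProb (f : C(X, ℝ)) :
    C(stateSpace X, ℝ) where
  toFun φ := (φ : WeakDual ℝ C(X, ℝ)) f
  continuous_toFun := (WeakDual.eval_continuous f).comp continuous_subtype_val


/-- Every invariant probability measure is the barycenter of a probability measure concentrated on
ergodic measures. -/
theorem exists_ergodicDecomposition {T : C(X, X)} {μ : ProbabilityMeasure X}
    (hμ : μ ∈ invariantMeasures T) :
    ∃ m : ProbabilityMeasure
        (stateSpace X),
      (∀ᵐ φ : stateSpace X ∂(m : Measure (stateSpace X)), ∃ ν : ProbabilityMeasure X, ν ∈ invariantMeasures T ∧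
        Ergodic T (ν : Measure X) ∧ measureToDual ν = (φ : WeakDual ℝ C(X, ℝ))) ∧
      ∀ f, ∫ φ, evalProb f φ ∂(m : Measure (stateSpace X)) = ∫ x, f x ∂(μ : Measure X) := by
  have hemp (n : ℕ) : AEMeasurable (empiricalFunctional T n) (μ : Measure X) :=
    (continuous_empiricalFunctional T n).measurable.aemeasurable
  -- An ultrafilter replaces the choice of a convergent subsequence; every limit below is taken
  -- along it.
  let U : Filter ℕ := hyperfilter ℕ
  obtain ⟨m, -, hm⟩ := isCompact_univ.ultrafilter_le_nhds
    ((hyperfilter ℕ).map fun n => μ.map (hemp n)) (by simp)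
  have hm' : Tendsto (fun n => μ.map (hemp n)) U (𝓝 m) := hm
  have hconv (g : C(stateSpace X, ℝ)) :
      Tendsto (fun n => ∫ x, g (empiricalFunctional T n x) ∂(μ : Measure X)) U
        (𝓝 (∫ φ, g φ ∂(m : Measure (stateSpace X)))) := by
    refine (ProbabilityMeasure.tendsto_iff_forall_integral_tendsto.mp hm'
      (BoundedContinuousFunction.mkOfCompact g)).congr fun n => ?_
    exact integral_map (hemp n) g.continuous.aestronglyMeasurable
  have hbary (f : C(X, ℝ)) : ∫ φ, evalProb f φ ∂(m : Measure (stateSpace X)) = ∫ x, f x ∂(μ : Measure X) := by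
    refine tendsto_nhds_unique (hconv (evalProb f)) (tendsto_const_nhds.congr fun n => ?_)
    rw [← integral_birkhoffMap hμ n.succ_ne_zero f]
    exact integral_congr_ae (Eventually.of_forall fun x => (empiricalFunctional_apply T n x f).symm)
  have hU : U ≤ atTop := Nat.hyperfilter_le_atTop
  have hinv (f : C(X, ℝ)) : ∀ᵐ φ ∂(m : Measure (stateSpace X)), evalProb (f.comp T) φ = evalProb f φ := by
    let g := |evalProb (f.comp T) - evalProb f|
    have hlim : Tendsto (fun n => ∫ x, g (empiricalFunctional T n x) ∂(μ : Measure X)) U (𝓝 0) := by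
      have hz : Tendsto (fun n : ℕ => 2 * ‖f‖ * (1 / ((n : ℝ) + 1))) U (𝓝 0) := by
        simpa using (tendsto_one_div_add_atTop_nhds_zero_nat.const_mul (2 * ‖f‖)).mono_left hU
      refine squeeze_zero (fun n => integral_nonneg fun x => abs_nonneg _) (fun n => ?_) hz
      have hle (x : X) : g (empiricalFunctional T n x) ≤ 2 * ‖f‖ * (1 / ((n : ℝ) + 1)) := by
        change |(empiricalFunctional T n x : WeakDual ℝ C(X, ℝ)) (f.comp T) -
          (empiricalFunctional T n x : WeakDual ℝ C(X, ℝ)) f| ≤ _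
        rw [empiricalFunctional_apply, empiricalFunctional_apply]
        exact abs_birkhoffMap_comp_sub_le T n f x
      calc ∫ x, g (empiricalFunctional T n x) ∂(μ : Measure X)
          ≤ ∫ x, 2 * ‖f‖ * (1 / ((n : ℝ) + 1)) ∂(μ : Measure X) :=
            integral_mono_of_nonneg (Eventually.of_forall fun x => abs_nonneg _)
              (integrable_const _) (Eventually.of_forall hle)
        _ = 2 * ‖f‖ * (1 / ((n : ℝ) + 1)) := by simp
    have h0 := tendsto_nhds_unique (hconv g) hlim
    rw [integral_eq_zero_iff_of_nonneg (f := g) (fun φ => abs_nonneg _) (g.integrable_of_compactSpace _)]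
      at h0
    filter_upwards [h0] with φ hφ
    exact sub_eq_zero.mp (abs_eq_zero.mp hφ)
  have hinv' : ∀ᵐ φ : stateSpace X ∂(m : Measure (stateSpace X)), ∃ ν : ProbabilityMeasure X, ν ∈ invariantMeasures T ∧
      measureToDual ν = (φ : WeakDual ℝ C(X, ℝ)) := by
    -- The exceptional null set depends on `f`; a countable dense family leaves a single one.
    obtain ⟨D, hDc, hD⟩ := TopologicalSpace.exists_countable_dense C(X, ℝ)
    filter_upwards [(ae_ball_iff hDc).mpr fun f _ => hinv f] with φ hφ
    obtain ⟨ν, hν⟩ := φ.2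
    refine ⟨ν, (measurePreserving_iff_forall_integral T.continuous).mpr fun f => ?_, hν⟩
    have h1 : Continuous fun f : C(X, ℝ) => measureToDual ν (f.comp T) :=
      (ContinuousLinearMap.continuous _).comp (by fun_prop)
    have h2 : Continuous fun f : C(X, ℝ) => measureToDual ν f := ContinuousLinearMap.continuous _
    exact congrFun (h1.ext_on hD h2 fun f hf => by rw [hν]; exact hφ f hf) f
  have hvar (f : C(X, ℝ)) : ∀ᵐ φ ∂(m : Measure (stateSpace X)), ∀ ε > 0, ∃ N : ℕ,
      evalProb (birkhoffMap T (N + 1) f ^ 2) φ - evalProb f φ ^ 2 < ε := by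
    refine ae_forall_exists_lt_of_tendsto_integral (l := U) (fun N => ?_) (fun N => ?_) ?_
    · exact ((evalProb (birkhoffMap T (N + 1) f ^ 2)) - evalProb f ^ 2).integrable_of_compactSpace _
    -- For an invariant `φ` the difference is the variance of the Birkhoff average, hence
    -- nonnegative.
    · filter_upwards [hinv'] with φ ⟨ν, hν, hνφ⟩
      have hint : ∫ x, birkhoffMap T (N + 1) f x ∂(ν : Measure X) = ∫ x, f x ∂(ν : Measure X) :=
        integral_birkhoffMap hν N.succ_ne_zero f
      have hvar := ProbabilityTheory.variance_nonneg (birkhoffMap T (N + 1) f) (ν : Measure X)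
      rw [ProbabilityTheory.variance_eq_sub ((birkhoffMap T (N + 1) f).memLp_of_compactSpace _ 2),
        hint] at hvar
      change 0 ≤ (φ : WeakDual ℝ C(X, ℝ)) _ - (φ : WeakDual ℝ C(X, ℝ)) _ ^ 2
      rw [← hνφ]
      exact hvar
    -- The barycenter property turns the first term into `∫ (A f)² dμ` with `A f` the Birkhoff
    -- average. Since `A f` at `x` is the empirical measure of `x` evaluated at `f`, this tends to
    -- `∫ φ(f)² dm`, the term being subtracted.
    · have h1 (N : ℕ) : ∫ φ, (evalProb (birkhoffMap T (N + 1) f ^ 2) φ - evalProb f φ ^ 2)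
            ∂(m : Measure (stateSpace X)) =
          ∫ x, birkhoffMap T (N + 1) f x ^ 2 ∂(μ : Measure X) -
            ∫ φ, evalProb f φ ^ 2 ∂(m : Measure (stateSpace X)) := by
        rw [integral_sub (ContinuousMap.integrable_of_compactSpace _ _), hbary]
        · rfl
        · exact (evalProb f ^ 2).integrable_of_compactSpace (m : Measure (stateSpace X))
      simp_rw [h1]
      rw [← sub_self (∫ φ, evalProb f φ ^ 2 ∂(m : Measure (stateSpace X)))]
      refine Tendsto.sub_const ((hconv (evalProb f ^ 2)).congr fun N => ?_) _
      refine integral_congr_ae (Eventually.of_forall fun x => ?_)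
      change (empiricalFunctional T N x : WeakDual ℝ C(X, ℝ)) f ^ 2 = _
      rw [empiricalFunctional_apply]
  refine ⟨m, ?_, hbary⟩
  obtain ⟨D, hDc, hD⟩ := TopologicalSpace.exists_countable_dense C(X, ℝ)
  filter_upwards [hinv', (ae_ball_iff hDc).mpr fun f _ => hvar f] with φ ⟨ν, hν, hνφ⟩ hφ
  refine ⟨ν, hν, ergodic_of_forall_exists_variance_lt hν hD fun f hf ε hε => ?_, hνφ⟩
  obtain ⟨N, hN⟩ := hφ f hf ε hε
  refine ⟨N, ?_⟩
  change (φ : WeakDual ℝ C(X, ℝ)) _ - (φ : WeakDual ℝ C(X, ℝ)) _ ^ 2 < ε at hN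
  rw [← hνφ] at hN
  exact hN

end ErgodicDecomposition

/-! ### Uniqueness of the ergodic decomposition, and the simplex property. -/

section Uniqueness

open Filter Topology

variable {X : Type*} [TopologicalSpace X]

theorem birkhoffMap_eq_smul_sum (T : C(X, X)) (N : ℕ) (f : C(X, ℝ)) :
    birkhoffMap T N f =
      (N : ℝ)⁻¹ • ∑ k ∈ Finset.range N, f.comp ⟨T^[k], T.continuous.iterate k⟩ := by
  ext x
  simp [birkhoffMap_apply]

theorem norm_birkhoffMap_le [CompactSpace X] (T : C(X, X)) (N : ℕ) (f : C(X, ℝ)) :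
    ‖birkhoffMap T N f‖ ≤ ‖f‖ := by
  rw [ContinuousMap.norm_le _ (norm_nonneg f)]
  intro x
  rw [birkhoffMap_apply, norm_mul, norm_inv, Real.norm_natCast]
  rcases N.eq_zero_or_pos with rfl | hN
  · simp
  · rw [inv_mul_le_iff₀ (by positivity)]
    refine (norm_sum_le_of_le _ fun k _ => f.norm_coe_le_norm _).trans ?_
    simp

variable [CompactSpace X] [MeasurableSpace X] [BorelSpace X]

theorem integrable_abs_sub_const (F : C(X, ℝ)) (a : ℝ) (μ : Measure X) [IsFiniteMeasure μ] :
    Integrable (fun x => |F x - a|) μ :=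
  ((F.integrable_of_compactSpace μ).sub (integrable_const a)).abs

/-- The mean ergodic theorem in `L¹` for continuous functions. -/
theorem tendsto_integral_abs_birkhoffMap_sub {T : C(X, X)} {μ : Measure X}
    [IsProbabilityMeasure μ] (hμ : Ergodic T μ) (f : C(X, ℝ)) :
    Tendsto (fun N => ∫ x, |birkhoffMap T N f x - ∫ x, f x ∂μ| ∂μ) atTop (𝓝 0) := by
  -- The Koopman operator on `L²`. Von Neumann's theorem gives convergence to a fixed vector, which
  -- ergodicity makes constant; the constant is found at the end, as Birkhoff averages keep the
  -- integral.
  let U : Lp ℝ 2 μ →L[ℝ] Lp ℝ 2 μ :=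
    (Lp.compMeasurePreservingₗᵢ ℝ T hμ.toMeasurePreserving).toContinuousLinearMap
  have hUf (f : C(X, ℝ)) : U (ContinuousMap.toLp 2 μ ℝ f) =
      ContinuousMap.toLp 2 μ ℝ (f.comp T) := by
    refine Lp.ext ?_
    refine (Lp.coeFn_compMeasurePreserving (ContinuousMap.toLp (E := ℝ) 2 μ ℝ f)
      hμ.toMeasurePreserving).trans ?_
    refine (hμ.toMeasurePreserving.quasiMeasurePreserving.ae_eq_comp
      (ContinuousMap.coeFn_toLp μ f)).trans ?_
    exact (ContinuousMap.coeFn_toLp μ (f.comp T)).symm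
  have hUk (k : ℕ) : U^[k] (ContinuousMap.toLp 2 μ ℝ f) =
      ContinuousMap.toLp 2 μ ℝ (f.comp ⟨T^[k], T.continuous.iterate k⟩) := by
    induction k with
    | zero => rfl
    | succ k ih =>
      rw [Function.iterate_succ_apply', ih, hUf]
      congr 1
  have hA (N : ℕ) : birkhoffAverage ℝ U _root_.id N (ContinuousMap.toLp 2 μ ℝ f) =
      ContinuousMap.toLp 2 μ ℝ (birkhoffMap T N f) := by
    rw [birkhoffMap_eq_smul_sum, map_smul, map_sum]
    simp [birkhoffAverage, birkhoffSum, hUk]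
  have hlim := U.tendsto_birkhoffAverage_orthogonalProjection
    (LinearIsometry.norm_toContinuousLinearMap_le _) (ContinuousMap.toLp 2 μ ℝ f)
  simp only [hA] at hlim
  generalize hy : (U.eqLocus (1 : Lp ℝ 2 μ →L[ℝ] Lp ℝ 2 μ)).orthogonalProjectionOnto
    (ContinuousMap.toLp 2 μ ℝ f) = y at hlim
  obtain ⟨y, hyU⟩ := y
  have hyU' : U y = y := hyU
  obtain ⟨c, hc⟩ : ∃ c, y =ᵐ[μ] Function.const X c := by
    refine hμ.ae_eq_const_of_ae_eq_comp_ae (Lp.aestronglyMeasurable y) ?_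
    refine (Lp.coeFn_compMeasurePreserving y hμ.toMeasurePreserving).symm.trans ?_
    exact Filter.EventuallyEq.of_eq (congrArg (fun z : Lp ℝ 2 μ => (z : X → ℝ)) hyU')
  have hlim2 : Tendsto (fun N => eLpNorm (fun x => birkhoffMap T N f x - c) 2 μ) atTop (𝓝 0) := by
    refine ((Lp.tendsto_Lp_iff_tendsto_eLpNorm' _ _).mp hlim).congr fun N => ?_
    exact eLpNorm_congr_ae ((ContinuousMap.coeFn_toLp μ (birkhoffMap T N f)).sub hc)
  have hlim1 : Tendsto (fun N => ∫ x, |birkhoffMap T N f x - c| ∂μ) atTop (𝓝 0) := by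
    rw [← ENNReal.toReal_zero]
    have h1 : Tendsto (fun N => eLpNorm (fun x => birkhoffMap T N f x - c) 1 μ) atTop (𝓝 0) :=
      tendsto_of_tendsto_of_tendsto_of_le_of_le tendsto_const_nhds hlim2 (fun _ => bot_le)
        fun N => eLpNorm_le_eLpNorm_of_exponent_le (by norm_num)
          ((birkhoffMap T N f).continuous.sub continuous_const).aestronglyMeasurable
    refine ((ENNReal.tendsto_toReal ENNReal.zero_ne_top).comp h1).congr fun N => ?_
    rw [Function.comp_apply, eLpNorm_one_eq_lintegral_enorm, ← integral_norm_eq_lintegral_enorm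
      (f := fun x => birkhoffMap T N f x - c) ((birkhoffMap T N f).continuous.sub continuous_const).aestronglyMeasurable]
    rfl
  have hcf : ∫ x, f x ∂μ = c := by
    rw [← sub_eq_zero, ← abs_nonpos_iff]
    refine ge_of_tendsto hlim1 ((eventually_ne_atTop 0).mono fun N hN => ?_)
    rw [← integral_birkhoffMap hμ.toMeasurePreserving hN f]
    have : ∫ x, birkhoffMap T N f x ∂μ - c = ∫ x, (birkhoffMap T N f x - c) ∂μ := by
      rw [integral_sub ((birkhoffMap T N f).integrable_of_compactSpace μ) (integrable_const _)]
      simp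
    rw [this]
    exact abs_integral_le_integral_abs
  rwa [hcf]

/-- The continuous functions of an ergodic measure that can be recovered, in the `L¹` sense, as
limits of a bounded sequence of continuous functions of the point. -/
def approximableSubalgebra (T : C(X, X)) : Subalgebra ℝ C(stateSpace X, ℝ) where
  carrier := {g | ∃ (F : ℕ → C(X, ℝ)) (C : ℝ), (∀ n, ‖F n‖ ≤ C) ∧
    ∀ ν : ProbabilityMeasure X, Ergodic T (ν : Measure X) →
      Tendsto (fun n => ∫ x, |F n x - g ⟨measureToDual ν, ν, rfl⟩| ∂(ν : Measure X)) atTop (𝓝 0)}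
  mul_mem' := by
    rintro g g' ⟨F, C, hC, hF⟩ ⟨F', C', hC', hF'⟩
    refine ⟨fun n => F n * F' n, C * C', fun n => (norm_mul_le _ _).trans
      (mul_le_mul (hC n) (hC' n) (norm_nonneg _) ((norm_nonneg _).trans (hC n))),
      fun ν hν => ?_⟩
    set a := g ⟨measureToDual ν, ν, rfl⟩ with ha
    set a' := g' ⟨measureToDual ν, ν, rfl⟩ with ha'
    have h0 : Tendsto (fun n => C' * ∫ x, |F n x - a| ∂(ν : Measure X) +
        |a| * ∫ x, |F' n x - a'| ∂(ν : Measure X)) atTop (𝓝 0) := by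
      simpa using ((hF ν hν).const_mul C').add ((hF' ν hν).const_mul |a|)
    refine squeeze_zero (fun n => integral_nonneg fun x => abs_nonneg _) (fun n => ?_) h0
    rw [← integral_const_mul, ← integral_const_mul,
      ← integral_add ((integrable_abs_sub_const _ _ _).const_mul _)
        ((integrable_abs_sub_const _ _ _).const_mul _)]
    refine integral_mono (integrable_abs_sub_const (F n * F' n) _ _)
      (((integrable_abs_sub_const _ _ _).const_mul _).add
        ((integrable_abs_sub_const _ _ _).const_mul _)) fun x => ?_
    change |F n x * F' n x - a * a'| ≤ C' * |F n x - a| + |a| * |F' n x - a'|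
    -- Here the uniform bound on the approximating sequence is needed: `L¹` convergence alone is not
    -- stable under products.
    have e : F n x * F' n x - a * a' = F' n x * (F n x - a) + a * (F' n x - a') := by ring
    rw [e]
    refine (abs_add_le _ _).trans ?_
    rw [abs_mul, abs_mul]
    gcongr
    exact ((F' n).norm_coe_le_norm x).trans (hC' n)
  add_mem' := by
    rintro g g' ⟨F, C, hC, hF⟩ ⟨F', C', hC', hF'⟩
    refine ⟨fun n => F n + F' n, C + C', fun n => (norm_add_le _ _).trans
      (add_le_add (hC n) (hC' n)), fun ν hν => ?_⟩
    set a := g ⟨measureToDual ν, ν, rfl⟩ with ha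
    set a' := g' ⟨measureToDual ν, ν, rfl⟩ with ha'
    have h0 := (hF ν hν).add (hF' ν hν)
    rw [add_zero] at h0
    refine squeeze_zero (fun n => integral_nonneg fun x => abs_nonneg _) (fun n => ?_) h0
    rw [← integral_add (integrable_abs_sub_const _ _ _) (integrable_abs_sub_const _ _ _)]
    refine integral_mono (integrable_abs_sub_const (F n + F' n) _ _)
      ((integrable_abs_sub_const _ _ _).add (integrable_abs_sub_const _ _ _)) fun x => ?_
    change |F n x + F' n x - (a + a')| ≤ |F n x - a| + |F' n x - a'|
    rw [add_sub_add_comm]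
    exact abs_add_le _ _
  algebraMap_mem' r := by
    refine ⟨fun _ => ContinuousMap.const X r, ‖ContinuousMap.const X r‖, fun _ => le_rfl,
      fun ν _ => ?_⟩
    simp [Algebra.algebraMap_eq_smul_one]

theorem evalProb_mem_approximableSubalgebra (T : C(X, X)) (f : C(X, ℝ)) :
    evalProb f ∈ approximableSubalgebra T :=
  ⟨fun n => birkhoffMap T n f, ‖f‖, fun n => norm_birkhoffMap_le T n f,
    fun _ hν => tendsto_integral_abs_birkhoffMap_sub hν f⟩

theorem separatesPoints_approximableSubalgebra (T : C(X, X)) :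
    (approximableSubalgebra T).SeparatesPoints := by
  intro φ ψ hne
  obtain ⟨f, hf⟩ : ∃ f, (φ : WeakDual ℝ C(X, ℝ)) f ≠ (ψ : WeakDual ℝ C(X, ℝ)) f := by
    by_contra! h
    exact hne (Subtype.ext (DFunLike.ext _ _ h))
  exact ⟨evalProb f, ⟨_, evalProb_mem_approximableSubalgebra T f, rfl⟩, hf⟩

theorem abs_evalProb_le (f : C(X, ℝ)) (φ : stateSpace X) : |evalProb f φ| ≤ ‖f‖ := by
  obtain ⟨_, ν, rfl⟩ := φ
  simpa [evalProb, measureToDual_apply] using norm_integral_le_of_norm_le_const (μ := (ν : Measure X))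
    (Eventually.of_forall f.norm_coe_le_norm)

variable [TopologicalSpace.MetrizableSpace X]

/-- A probability measure concentrated on ergodic measures is determined by its barycenter. -/
theorem eq_of_forall_integral_evalProb_eq {T : C(X, X)} {m m' : Measure (stateSpace X)}
    [IsProbabilityMeasure m] [IsProbabilityMeasure m']
    (hm : ∀ᵐ φ : stateSpace X ∂m, ∃ ν : ProbabilityMeasure X, Ergodic T (ν : Measure X) ∧
      measureToDual ν = (φ : WeakDual ℝ C(X, ℝ)))
    (hm' : ∀ᵐ φ : stateSpace X ∂m', ∃ ν : ProbabilityMeasure X, Ergodic T (ν : Measure X) ∧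
      measureToDual ν = (φ : WeakDual ℝ C(X, ℝ)))
    (h : ∀ f, ∫ φ, evalProb f φ ∂m = ∫ φ, evalProb f φ ∂m') : m = m' := by
  have hA : ∀ g ∈ approximableSubalgebra T, ∫ φ, g φ ∂m = ∫ φ, g φ ∂m' := by
    rintro g ⟨F, C, hC, hF⟩
    -- At an ergodic `ν` the number `∫ F n dν` tends to `g ν`; the uniform bound `C` allows
    -- dominated convergence.
    have key (m : Measure (stateSpace X)) [IsProbabilityMeasure m]
        (hm : ∀ᵐ φ : stateSpace X ∂m, ∃ ν : ProbabilityMeasure X, Ergodic T (ν : Measure X) ∧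
          measureToDual ν = (φ : WeakDual ℝ C(X, ℝ))) :
        Tendsto (fun n => ∫ φ, evalProb (F n) φ ∂m) atTop (𝓝 (∫ φ, g φ ∂m)) := by
      refine tendsto_integral_of_dominated_convergence (fun _ => C)
        (fun n => (evalProb (F n)).continuous.aestronglyMeasurable) (integrable_const _)
        (fun n => Eventually.of_forall fun φ => (abs_evalProb_le _ _).trans (hC n)) ?_
      filter_upwards [hm] with φ ⟨ν, hν, hνφ⟩
      obtain rfl : φ = ⟨measureToDual ν, ν, rfl⟩ := Subtype.ext hνφ.symm
      rw [tendsto_iff_norm_sub_tendsto_zero]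
      refine squeeze_zero (fun n => norm_nonneg _) (fun n => ?_) (hF ν hν)
      have e : evalProb (F n) ⟨measureToDual ν, ν, rfl⟩ - g ⟨measureToDual ν, ν, rfl⟩ =
          ∫ x, (F n x - g ⟨measureToDual ν, ν, rfl⟩) ∂(ν : Measure X) := by
        rw [integral_sub ((F n).integrable_of_compactSpace _) (integrable_const _)]
        simp [evalProb, measureToDual_apply]
      rw [e]
      exact abs_integral_le_integral_abs
    exact tendsto_nhds_unique (key m hm) ((key m' hm').congr fun n => (h (F n)).symm)
  refine Measure.ext_of_forall_integral_continuousMap_eq fun g => ?_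
  have hdense : Dense (approximableSubalgebra T : Set C(stateSpace X, ℝ)) := by
    rw [dense_iff_closure_eq, ← Subalgebra.topologicalClosure_coe,
      ContinuousMap.subalgebra_topologicalClosure_eq_top_of_separatesPoints _
        (separatesPoints_approximableSubalgebra T)]
    rfl
  exact congrFun ((continuous_integral_continuousMap m).ext_on hdense
    (continuous_integral_continuousMap m') hA) g

/-- The invariant measures of a continuous map of a compact metrizable space form a simplex. -/
theorem isSimplex_image_invariantMeasures (T : C(X, X)) :
    IsSimplex (measureToDual '' invariantMeasures T) where
  convex := convex_invariantMeasures T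
  isCompact := isCompact_image_invariantMeasures T.continuous
  metrizable := metrizableSpace_image_measureToDual _
  existsUnique_representing := by
    have hS : IsClosed (stateSpace X) := isClosedEmbedding_measureToDual.isClosed_range
    have hemb : MeasurableEmbedding (Subtype.val : stateSpace X → WeakDual ℝ C(X, ℝ)) :=
      MeasurableEmbedding.subtype_coe hS.measurableSet
    rw [extremePoints_image_invariantMeasures]
    rintro _ ⟨μ, hμ, rfl⟩
    obtain ⟨m, hm, hbary⟩ := exists_ergodicDecomposition hμ
    refine ⟨m.map hemb.measurable.aemeasurable, ⟨?_, fun F => ?_⟩, ?_⟩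
    · refine (hemb.ae_map_iff).mpr ?_
      filter_upwards [hm] with φ ⟨ν, hν, hνe, hνφ⟩
      exact ⟨ν, ⟨hν, hνe⟩, hνφ⟩
    · obtain ⟨f, hf⟩ := WeakDual.exists_eval_eq F
      simp only [hf]
      exact (hemb.integral_map _).trans (hbary f)
    · rintro m' ⟨hm', hbary'⟩
      have hmem : ∀ᵐ φ ∂(m' : Measure (WeakDual ℝ C(X, ℝ))), φ ∈ Set.range
          (Subtype.val : stateSpace X → WeakDual ℝ C(X, ℝ)) := by
        filter_upwards [hm'] with φ ⟨ν, _, hν⟩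
        exact ⟨⟨φ, ν, hν⟩, rfl⟩
      -- A competing representing measure lives on the state space, since the extreme points are
      -- probability measures, so it can be pulled back there.
      have hmap : ((m' : Measure (WeakDual ℝ C(X, ℝ))).comap
          (Subtype.val : stateSpace X → WeakDual ℝ C(X, ℝ))).map Subtype.val = m' := by
        rw [hemb.map_comap, Measure.restrict_eq_self_of_ae_mem hmem]
      have hprob : IsProbabilityMeasure ((m' : Measure (WeakDual ℝ C(X, ℝ))).comap
          (Subtype.val : stateSpace X → WeakDual ℝ C(X, ℝ))) := by
        refine ⟨?_⟩
        have := congrArg (fun m => m Set.univ) hmap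
        simpa [hemb.map_apply] using this
      apply Subtype.ext
      change (m' : Measure (WeakDual ℝ C(X, ℝ))) = (m : Measure (stateSpace X)).map Subtype.val
      rw [← hmap]
      congr 1
      refine eq_of_forall_integral_evalProb_eq (T := T) ?_ ?_ fun f => ?_
      · rw [← hmap] at hm'
        filter_upwards [hemb.ae_map_iff.mp hm'] with φ ⟨ν, ⟨_, hν⟩, hνφ⟩
        exact ⟨ν, hν, hνφ⟩
      · filter_upwards [hm] with φ ⟨ν, _, hν, hνφ⟩
        exact ⟨ν, hν, hνφ⟩
      · rw [hbary]
        have := hbary' (WeakBilin.eval (topDualPairing ℝ C(X, ℝ)) f)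
        rw [← hmap, hemb.integral_map] at this
        exact this

end Uniqueness

/-! ### Transport of simplices along linear embeddings with a continuous left inverse. -/

section Transport

variable {E F : Type*} [AddCommGroup E] [Module ℝ E] [TopologicalSpace E]
  [IsTopologicalAddGroup E] [ContinuousSMul ℝ E] [LocallyConvexSpace ℝ E] [T2Space E]
  [MeasurableSpace E] [BorelSpace E] [AddCommGroup F] [Module ℝ F] [TopologicalSpace F]
  [IsTopologicalAddGroup F] [ContinuousSMul ℝ F] [LocallyConvexSpace ℝ F] [T2Space F]
  [MeasurableSpace F] [BorelSpace F]

theorem extremePoints_image_of_injective {E F : Type*} [AddCommGroup E] [Module ℝ E]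
    [AddCommGroup F] [Module ℝ F] (φ : E →ₗ[ℝ] F) (hφ : Function.Injective φ) (K : Set E) :
    (φ '' K).extremePoints ℝ = φ '' K.extremePoints ℝ := by
  ext y
  constructor
  · rintro ⟨⟨x, hx, rfl⟩, h⟩
    refine ⟨x, ⟨hx, fun x₁ h₁ x₂ h₂ ⟨a, b, ha, hb, hab, he⟩ => hφ ?_⟩, rfl⟩
    exact h ⟨x₁, h₁, rfl⟩ ⟨x₂, h₂, rfl⟩ ⟨a, b, ha, hb, hab, by simp [← he]⟩
  · rintro ⟨x, ⟨hx, h⟩, rfl⟩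
    refine ⟨⟨x, hx, rfl⟩, ?_⟩
    rintro _ ⟨x₁, h₁, rfl⟩ _ ⟨x₂, h₂, rfl⟩ ⟨a, b, ha, hb, hab, he⟩
    refine congrArg φ (h h₁ h₂ ⟨a, b, ha, hb, hab, hφ ?_⟩)
    simpa using he

/-- The left inverse plays two roles: it makes `φ` a closed embedding, so that measures on the image
pull back, and it extends each functional `f` on `E` to `f ∘ ψ`, so that the pulled-back measure
keeps the barycenter. -/
theorem IsSimplex.image {K : Set E} (hK : IsSimplex K) (φ : E →L[ℝ] F) (ψ : F →L[ℝ] E)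
    (h : Function.LeftInverse ψ φ) : IsSimplex (φ '' K) where
  convex := hK.convex.linear_image (φ : E →ₗ[ℝ] F)
  isCompact := hK.isCompact.image φ.continuous
  metrizable := by
    have := hK.metrizable
    have hemb := (h.isClosedEmbedding ψ.continuous φ.continuous).isEmbedding
    exact (hemb.homeomorphImage K).symm.isEmbedding.metrizableSpace
  existsUnique_representing := by
    have hemb : MeasurableEmbedding φ :=
      (h.isClosedEmbedding ψ.continuous φ.continuous).measurableEmbedding
    have hext := extremePoints_image_of_injective (φ : E →ₗ[ℝ] F) h.injective K
    simp only [ContinuousLinearMap.coe_coe] at hext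
    rw [hext]
    rintro _ ⟨ξ, hξ, rfl⟩
    obtain ⟨m, ⟨hm, hbary⟩, huniq⟩ := hK.existsUnique_representing ξ hξ
    refine ⟨m.map hemb.measurable.aemeasurable, ⟨?_, fun f => ?_⟩, ?_⟩
    · exact hemb.ae_map_iff.mpr (hm.mono fun x hx => ⟨x, hx, rfl⟩)
    · exact (hemb.integral_map _).trans (hbary (f.comp φ))
    · rintro m' ⟨hm', hbary'⟩
      have hmem : ∀ᵐ y ∂(m' : Measure F), y ∈ Set.range φ :=
        hm'.mono fun y ⟨x, _, hx⟩ => ⟨x, hx⟩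
      have hmap : ((m' : Measure F).comap φ).map φ = m' := by
        rw [hemb.map_comap, Measure.restrict_eq_self_of_ae_mem hmem]
      have hprob : IsProbabilityMeasure ((m' : Measure F).comap φ) := by
        refine ⟨?_⟩
        have := congrArg (fun m => m Set.univ) hmap
        simpa [hemb.map_apply] using this
      have key : (⟨(m' : Measure F).comap φ, hprob⟩ : ProbabilityMeasure E) = m := by
        refine huniq _ ⟨?_, fun f => ?_⟩
        · rw [← hmap] at hm'
          exact (hemb.ae_map_iff.mp hm').mono fun x ⟨z, hz, hzx⟩ => h.injective hzx ▸ hz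
        · have h1 := hbary' (f.comp ψ)
          rw [← hmap, hemb.integral_map] at h1
          simpa [h _] using h1
      apply Subtype.ext
      change (m' : Measure F) = (m : Measure E).map φ
      rw [← key]
      exact hmap.symm

theorem IsPoulsenSimplex.image {K : Set E} (hK : IsPoulsenSimplex K) (φ : E →L[ℝ] F)
    (ψ : F →L[ℝ] E) (h : Function.LeftInverse ψ φ) : IsPoulsenSimplex (φ '' K) where
  toIsSimplex := hK.toIsSimplex.image φ ψ h
  nontrivial := hK.nontrivial.image h.injective
  dense_extremePoints := by
    have hext := extremePoints_image_of_injective (φ : E →ₗ[ℝ] F) h.injective K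
    simp only [ContinuousLinearMap.coe_coe] at hext
    rw [hext]
    exact (Set.image_mono hK.dense_extremePoints).trans (image_closure_subset_closure_image
      φ.continuous)

end Transport

/-! ### Topology and measurability of the space of subgroups. -/

section SubgroupSpace

open Filter Topology

variable {G : Type*} [Group G]

theorem Subgroup.charFun_injective : Function.Injective (Subgroup.charFun : Subgroup G → _) := by
  intro H K h
  ext g
  simpa [Subgroup.charFun] using congrFun h g

theorem Subgroup.isEmbedding_charFun : IsEmbedding (Subgroup.charFun : Subgroup G → G → Bool) :=
  ⟨⟨rfl⟩, Subgroup.charFun_injective⟩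

instance Subgroup.instMetrizableSpaceSub [Countable G] :
    TopologicalSpace.MetrizableSpace (Subgroup G) :=
  Subgroup.isEmbedding_charFun.metrizableSpace

instance Subgroup.instSecondCountableTopologySub [Countable G] :
    SecondCountableTopology (Subgroup G) :=
  Subgroup.isEmbedding_charFun.secondCountableTopology

theorem Subgroup.isClopen_setOf_mem (g : G) : IsClopen {H : Subgroup G | g ∈ H} := by
  have : {H : Subgroup G | g ∈ H} = (fun H => H.charFun g) ⁻¹' {true} := by
    ext H
    simp [Subgroup.charFun]
  rw [this]
  exact (isClopen_discrete _).preimage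
    ((continuous_apply g).comp Subgroup.isEmbedding_charFun.continuous)

theorem Subgroup.continuous_iff_isClopen {Z : Type*} [TopologicalSpace Z] {f : Z → Subgroup G} :
    Continuous f ↔ ∀ g, IsClopen {z | g ∈ f z} := by
  refine ⟨fun h g => (Subgroup.isClopen_setOf_mem g).preimage h, fun h => ?_⟩
  rw [Subgroup.isEmbedding_charFun.continuous_iff, continuous_pi_iff]
  intro g
  refine (continuous_bool_rng true).mpr ?_
  convert h g using 1
  ext z
  simp [Subgroup.charFun]

theorem Subgroup.measurable_iff_forall_mem [Countable G] {Z : Type*} [MeasurableSpace Z]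
    {f : Z → Subgroup G} : Measurable f ↔ ∀ g, MeasurableSet {z | g ∈ f z} := by
  refine ⟨fun h g => h (Subgroup.isClopen_setOf_mem g).isOpen.measurableSet, fun h => ?_⟩
  have e : Subgroup.instMeasurableSpaceSub (G := G) =
      MeasurableSpace.comap Subgroup.charFun inferInstance := by
    rw [BorelSpace.measurable_eq (α := G → Bool)]
    exact borel_comap
  rw [e, measurable_comap_iff, measurable_pi_iff]
  intro g
  refine measurable_to_bool ?_
  convert h g using 1
  ext z
  simp [Subgroup.charFun]

/-- The subgroups that contain the same elements of the finite set `F` as `H`. -/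
def Subgroup.agreeSet (F : Finset G) (H : Subgroup G) : Set (Subgroup G) :=
  {K | ∀ g ∈ F, g ∈ K ↔ g ∈ H}

theorem Subgroup.isClopen_agreeSet (F : Finset G) (H : Subgroup G) :
    IsClopen (Subgroup.agreeSet F H) := by
  have : Subgroup.agreeSet F H = ⋂ g ∈ F, {K | g ∈ K ↔ g ∈ H} := by
    ext K
    simp [Subgroup.agreeSet]
  rw [this]
  refine isClopen_biInter_finset fun g _ => ?_
  by_cases hg : g ∈ H
  · simpa [hg] using Subgroup.isClopen_setOf_mem g
  · convert (Subgroup.isClopen_setOf_mem g).compl using 1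
    ext K
    simp [hg]

theorem Subgroup.exists_agreeSet_subset {u : Set (Subgroup G)} (hu : IsOpen u) {H : Subgroup G}
    (hH : H ∈ u) : ∃ F : Finset G, Subgroup.agreeSet F H ⊆ u := by
  obtain ⟨v, hv, rfl⟩ := Subgroup.isEmbedding_charFun.isOpen_iff.mp hu
  obtain ⟨I, w, hw, hsub⟩ := isOpen_pi_iff.mp hv _ hH
  refine ⟨I, fun K hK => hsub fun g hg => ?_⟩
  have : K.charFun g = H.charFun g := by simpa [Subgroup.charFun] using hK g hg
  rw [this]
  exact (hw g hg).2

/-- The clopen sets prescribing membership on a finite set form a π-system and a neighbourhood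
basis, hence determine convergence. -/
theorem Subgroup.tendsto_probabilityMeasure [Countable G] {ι : Type*} {l : Filter ι}
    [l.IsCountablyGenerated] {μ : ι → ProbabilityMeasure (Subgroup G)}
    {ν : ProbabilityMeasure (Subgroup G)}
    (h : ∀ (F : Finset G) (H : Subgroup G),
      Tendsto (fun i => (μ i : Measure (Subgroup G)).real (Subgroup.agreeSet F H)) l
        (𝓝 ((ν : Measure (Subgroup G)).real (Subgroup.agreeSet F H)))) : Tendsto μ l (𝓝 ν) := by
  classical
  refine IsPiSystem.tendsto_probabilityMeasure_of_tendsto_of_mem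
    (S := {s | ∃ F H, s = Subgroup.agreeSet F H}) ?_ ?_ ?_ ?_
  · rintro _ ⟨F, H, rfl⟩ _ ⟨F', H', rfl⟩ ⟨K, hK, hK'⟩
    refine ⟨F ∪ F', K, ?_⟩
    ext L
    simp only [Subgroup.agreeSet, Set.mem_inter_iff, Set.mem_ofPred_eq, Finset.mem_union] at *
    grind
  · rintro _ ⟨F, H, rfl⟩
    exact (Subgroup.isClopen_agreeSet F H).isOpen.measurableSet
  · intro u hu H hH
    obtain ⟨F, hF⟩ := Subgroup.exists_agreeSet_subset hu hH
    exact ⟨_, ⟨F, H, rfl⟩, (Subgroup.isClopen_agreeSet F H).isOpen.mem_nhds fun _ _ => Iff.rfl, hF⟩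
  · rintro _ ⟨F, H, rfl⟩
    exact NNReal.tendsto_coe.mp (h F H)

end SubgroupSpace

/-! ### Mixing on a π-system and ergodicity of Bernoulli shifts. -/

section Bernoulli

open Filter Topology

/-- Dynkin induction in the second set, with `A` fixed. Disjoint unions pass to the limit by
dominated convergence of series, with majorant `μ (f i)`. -/
theorem MeasureTheory.MeasurePreserving.tendsto_measure_inter_preimage_of_isPiSystem {Ω : Type*}
    [m : MeasurableSpace Ω] {μ : Measure Ω} [IsProbabilityMeasure μ] {σ : Ω → Ω}
    (hσ : MeasurePreserving σ μ μ) {S : Set (Set Ω)} (hS : IsPiSystem S)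
    (hgen : m = MeasurableSpace.generateFrom S) {A : Set Ω} (hA : MeasurableSet A)
    (h : ∀ C ∈ S, Tendsto (fun N : ℕ => μ.real (A ∩ σ^[N] ⁻¹' C)) atTop (𝓝 (μ.real A * μ.real C)))
    {C : Set Ω} (hC : MeasurableSet C) :
    Tendsto (fun N : ℕ => μ.real (A ∩ σ^[N] ⁻¹' C)) atTop (𝓝 (μ.real A * μ.real C)) := by
  have hm (N : ℕ) {C : Set Ω} (hC : MeasurableSet C) : MeasurableSet (σ^[N] ⁻¹' C) :=
    (hσ.iterate N).measurable hC
  induction C, hC using MeasurableSpace.induction_on_inter hgen hS with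
  | empty => simp
  | basic C hC => exact h C hC
  | compl C hC ih =>
    have h1 (N : ℕ) : μ.real (A ∩ σ^[N] ⁻¹' Cᶜ) = μ.real A - μ.real (A ∩ σ^[N] ⁻¹' C) := by
      rw [Set.preimage_compl, ← Set.sdiff_eq,
        ← measureReal_inter_add_sdiff (s := A) (hm N hC)]
      ring
    simp_rw [h1]
    have h2 : μ.real A * μ.real Cᶜ = μ.real A - μ.real A * μ.real C := by
      rw [probReal_compl_eq_one_sub hC]
      ring
    rw [h2]
    exact ih.const_sub _
  | iUnion f hd hf ih =>
    have hU (f : ℕ → Set Ω) (hd : Pairwise (Function.onFun Disjoint f))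
        (hf : ∀ i, MeasurableSet (f i)) : μ.real (⋃ i, f i) = ∑' i, μ.real (f i) := by
      rw [Measure.real, measure_iUnion hd hf, ENNReal.tsum_toReal_eq fun i => measure_ne_top _ _]
      rfl
    have h1 (N : ℕ) : μ.real (A ∩ σ^[N] ⁻¹' ⋃ i, f i) = ∑' i, μ.real (A ∩ σ^[N] ⁻¹' f i) := by
      rw [Set.preimage_iUnion, Set.inter_iUnion]
      refine hU _ (fun i j hij => ?_) fun i => hA.inter (hm N (hf i))
      exact ((hd hij).preimage _).mono Set.inter_subset_right Set.inter_subset_right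
    have hsum : Summable fun i => μ.real (f i) :=
      ENNReal.summable_toReal (by rw [← measure_iUnion hd hf]; exact measure_ne_top _ _)
    simp_rw [h1]
    rw [hU f hd hf, ← tsum_mul_left]
    refine tendsto_tsum_of_dominated_convergence hsum ih
      (Eventually.of_forall fun N i => ?_)
    rw [Real.norm_of_nonneg measureReal_nonneg, ← (hσ.iterate N).measureReal_preimage (hf i).nullMeasurableSet]
    exact measureReal_mono Set.inter_subset_right

/-- For an invariant set `B` in second position the mixing sequence is constant, so `B` is
independent of the π-system and hence of everything. -/
theorem ergodic_of_tendsto_measure_inter_preimage {Ω : Type*} [m : MeasurableSpace Ω]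
    {μ : Measure Ω} [IsProbabilityMeasure μ] {σ : Ω → Ω} (hσ : MeasurePreserving σ μ μ)
    {S : Set (Set Ω)} (hS : IsPiSystem S) (hgen : m = MeasurableSpace.generateFrom S)
    (h : ∀ A ∈ S, ∀ C ∈ S,
      Tendsto (fun N : ℕ => μ.real (A ∩ σ^[N] ⁻¹' C)) atTop (𝓝 (μ.real A * μ.real C))) :
    Ergodic σ μ := by
  refine ⟨hσ, ⟨fun {B} hB hσB => ?_⟩⟩
  have hmeas {A : Set Ω} (hA : A ∈ S) : MeasurableSet A :=
    hgen ▸ MeasurableSpace.measurableSet_generateFrom hA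
  have hBN (N : ℕ) : σ^[N] ⁻¹' B = B := by
    induction N with
    | zero => rfl
    | succ N ih => rw [Function.iterate_succ, Set.preimage_comp, ih, hσB]
  have hind (A : Set Ω) (hA : A ∈ S) : μ.real (A ∩ B) = μ.real A * μ.real B := by
    have := hσ.tendsto_measure_inter_preimage_of_isPiSystem hS hgen (hmeas hA) (h A hA) hB
    simp_rw [hBN] at this
    exact tendsto_nhds_unique tendsto_const_nhds this
  have hrestrict : μ.restrict B = μ B • μ := by
    have : IsFiniteMeasure (μ B • μ) := Measure.smul_finite _ (measure_ne_top _ _)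
    refine ext_of_generate_finite S hgen hS (fun A hA => ?_) (by simp)
    rw [Measure.restrict_apply (hmeas hA), Measure.smul_apply, smul_eq_mul,
      ← ENNReal.toReal_eq_toReal_iff' (measure_ne_top _ _)
        (ENNReal.mul_ne_top (measure_ne_top _ _) (measure_ne_top _ _)), ENNReal.toReal_mul, mul_comm]
    exact hind A hA
  exact eventuallyConst_of_restrict_eq_smul hB hrestrict

variable {Y : Type*} [MeasurableSpace Y]

theorem measurePreserving_comp_equiv_infinitePi {ι : Type*} (ν : Measure Y)
    [IsProbabilityMeasure ν] (e : ι ≃ ι) :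
    MeasurePreserving (fun (y : ι → Y) i => y (e i)) (Measure.infinitePi fun _ : ι => ν)
      (Measure.infinitePi fun _ : ι => ν) := by
  classical
  have hmeas : Measurable (fun (y : ι → Y) i => y (e i)) := by fun_prop
  refine ⟨hmeas, Measure.eq_infinitePi _ fun s t ht => ?_⟩
  rw [Measure.map_apply hmeas (MeasurableSet.pi s.countable_toSet fun i _ => ht i)]
  have : (fun (y : ι → Y) i => y (e i)) ⁻¹' (s : Set ι).pi t =
      ((s.map e.toEmbedding : Finset ι) : Set ι).pi fun i => t (e.symm i) := by
    ext y
    simp only [Set.mem_preimage, Set.mem_pi, Finset.mem_coe, Finset.mem_map_equiv]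
    exact ⟨fun h i hi => by simpa using h _ hi, fun h i hi => by simpa using h (e i) (by simpa)⟩
  rw [this, Measure.infinitePi_pi _ fun i _ => ht _]
  simp

/-- The Bernoulli shift over `ℤ` is ergodic. -/
theorem ergodic_shift_infinitePi (ν : Measure Y) [IsProbabilityMeasure ν] :
    Ergodic (fun (y : ℤ → Y) k => y (k - 1)) (Measure.infinitePi fun _ : ℤ => ν) := by
  classical
  have hσ := measurePreserving_comp_equiv_infinitePi ν (Equiv.subRight (1 : ℤ))
  refine ergodic_of_tendsto_measure_inter_preimage hσ
    (isPiSystem_squareCylinders (fun _ => MeasurableSpace.isPiSystem_measurableSet) (by simp))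
    generateFrom_squareCylinders.symm ?_
  rintro _ ⟨s, t, ht, rfl⟩ _ ⟨s', t', ht', rfl⟩
  simp only [Set.mem_pi, Set.mem_univ, Set.mem_ofPred_eq, forall_const] at ht ht'
  -- Far translates of a cylinder depend on coordinates disjoint from `s`, so the product formula is
  -- exact for large `N`.
  have hdisj : ∀ᶠ N : ℕ in atTop, ∀ k ∈ s', k - N ∉ s := by
    rw [eventually_all_finset]
    intro k _
    obtain ⟨b, hb⟩ := s.bddBelow
    filter_upwards [eventually_gt_atTop (k - b).toNat] with N hN hk
    have := hb hk
    omega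
  refine tendsto_const_nhds.congr' ?_
  filter_upwards [hdisj] with N hN
  have hiter (y : ℤ → Y) (k : ℤ) :
      (fun (y : ℤ → Y) k => y (k - 1))^[N] y k = y (k - N) := by
    clear hN
    induction N generalizing k with
    | zero => simp
    | succ N ih =>
      rw [Function.iterate_succ_apply', ih, sub_sub, Nat.cast_succ, add_comm]
  let e : ℤ ≃ ℤ := Equiv.subRight (N : ℤ)
  have hset : (s : Set ℤ).pi t ∩ (fun (y : ℤ → Y) k => y (k - 1))^[N] ⁻¹'
      (s' : Set ℤ).pi t' = ((s ∪ s'.map e.toEmbedding : Finset ℤ) : Set ℤ).pi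
        fun k => if k ∈ s then t k else t' (k + N) := by
    ext y
    simp only [Set.mem_inter_iff, Set.mem_preimage, Set.mem_pi, hiter, Finset.mem_coe,
      Finset.mem_union, Finset.mem_map_equiv]
    constructor
    · rintro ⟨h1, h2⟩ k hk
      split_ifs with hks
      · exact h1 k hks
      · simpa using h2 (k + N) (hk.resolve_left hks)
    · intro h
      refine ⟨fun k hk => by simpa [hk] using h k (Or.inl hk), fun k hk => ?_⟩
      have := h (k - N) (Or.inr (by simpa [e] using hk))
      rwa [if_neg (hN k hk), sub_add_cancel] at this
  have hd : Disjoint s (s'.map e.toEmbedding) := by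
    rw [Finset.disjoint_right]
    intro k hk hks
    simp only [Finset.mem_map_equiv] at hk
    exact hN _ hk (by simpa [e] using hks)
  have hreal (u : Finset ℤ) (v : ℤ → Set Y) (hv : ∀ i, MeasurableSet (v i)) :
      (Measure.infinitePi fun _ : ℤ => ν).real ((u : Set ℤ).pi v) = ∏ i ∈ u, ν.real (v i) := by
    rw [Measure.real, Measure.infinitePi_pi _ fun i _ => hv i, ENNReal.toReal_prod]
    rfl
  have hmeas (k : ℤ) : MeasurableSet (if k ∈ s then t k else t' (k + N)) := by
    split_ifs
    exacts [ht _, ht' _]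
  rw [hset, hreal s t ht, hreal s' t' ht', hreal _ (fun k => if k ∈ s then t k else t' (k + N)) hmeas,
    Finset.prod_union hd, Finset.prod_map]
  congr 1
  · exact (Finset.prod_congr rfl fun k hk => by simp [hk]).symm
  · refine (Finset.prod_congr rfl fun k hk => ?_).symm
    rw [show e.toEmbedding k = k - N from rfl, if_neg (hN k hk), sub_add_cancel]

end Bernoulli

open Filter Topology

/-! ### Averaging over a period. -/

section AverageOverPeriod

variable {Ω : Type*} [MeasurableSpace Ω] {β : Measure Ω} {τ : Ω → Ω} {m : ℕ}

theorem isProbabilityMeasure_average_map [IsProbabilityMeasure β] (hτ : Measurable τ) (hm : m ≠ 0) :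
    IsProbabilityMeasure ((m : ENNReal)⁻¹ • ∑ k ∈ Finset.range m, β.map τ^[k]) := by
  refine ⟨?_⟩
  have h (k : ℕ) : (β.map τ^[k]) Set.univ = 1 := by
    rw [Measure.map_apply (hτ.iterate k) .univ, Set.preimage_univ, measure_univ]
  simp only [Measure.smul_apply, Measure.coe_finsetSum, Finset.sum_apply, h, Finset.sum_const,
    Finset.card_range, nsmul_eq_mul, mul_one, smul_eq_mul]
  exact ENNReal.inv_mul_cancel (by simpa) (by simp)

/-- If `τ^m` is ergodic for `β`, then `τ` is ergodic for the average of the translates of `β`. -/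
theorem ergodic_average_map (hτ : Measurable τ) (hm : m ≠ 0) (h : Ergodic τ^[m] β) :
    Ergodic τ ((m : ENNReal)⁻¹ • ∑ k ∈ Finset.range m, β.map τ^[k]) := by
  refine ⟨⟨hτ, ?_⟩, ⟨fun {B} hB hτB => ?_⟩⟩
  · rw [Measure.map_smul]
    congr 1
    have h1 (s : Finset ℕ) : (∑ k ∈ s, β.map τ^[k]).map τ = ∑ k ∈ s, β.map τ^[k + 1] := by
      induction s using Finset.cons_induction with
      | empty => simp
      | cons a s ha ih =>
        rw [Finset.sum_cons, Finset.sum_cons, Measure.map_add _ _ hτ, ih,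
          Measure.map_map hτ (hτ.iterate a), ← Function.iterate_succ' τ a]
    -- Applying `τ` permutes the summands cyclically: the last one becomes the image of `β` under
    -- `τ^m`, which is `β`.
    obtain ⟨m, rfl⟩ := Nat.exists_eq_succ_of_ne_zero hm
    rw [h1, Finset.sum_range_succ, Finset.sum_range_succ' (fun k => β.map τ^[k])]
    congr 1
    rw [h.toMeasurePreserving.map_eq]
    simp
  -- On `τ`-invariant sets the average coincides with `β`, and such sets are also `τ^m`-invariant.
  · have hk {B : Set Ω} (hB : MeasurableSet B) (hτB : τ ⁻¹' B = B) :
        ((m : ENNReal)⁻¹ • ∑ k ∈ Finset.range m, β.map τ^[k]) B = β B := by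
      have hpre (k : ℕ) : τ^[k] ⁻¹' B = B := by
        induction k with
        | zero => rfl
        | succ k ih => rw [Function.iterate_succ, Set.preimage_comp, ih, hτB]
      simp only [Measure.smul_apply, Measure.coe_finsetSum, Finset.sum_apply,
        Measure.map_apply (hτ.iterate _) hB, hpre, Finset.sum_const,
        Finset.card_range, nsmul_eq_mul, smul_eq_mul]
      rw [← mul_assoc, ENNReal.inv_mul_cancel (by simpa) (by simp), one_mul]
    have hBm : τ^[m] ⁻¹' B = B := by
      clear hm h hk
      induction m with
      | zero => rfl
      | succ k ih => rw [Function.iterate_succ, Set.preimage_comp, ih, hτB]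
    have hconst := h.aeconst_set hB hBm
    rw [eventuallyConst_set', ae_eq_empty, ae_eq_univ] at hconst ⊢
    rwa [hk hB hτB, hk hB.compl (by rw [Set.preimage_compl, hτB])]

end AverageOverPeriod

/-! ### Block sums, and density of the ergodic measures. -/

namespace Lamplighter

variable {n p : ℕ}

instance instCountableZMod : Countable (ZMod p) := by
  cases p
  · exact inferInstanceAs (Countable ℤ)
  · infer_instance

instance instCountableLampGroup : Countable (LampGroup n p) :=
  inferInstanceAs (Countable (ℤ →₀ (Fin n → ZMod p)))

theorem LampGroup.ext {v w : LampGroup n p} (h : ∀ i, v.toAdd i = w.toAdd i) : v = w :=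
  Multiplicative.toAdd.injective (Finsupp.ext h)

theorem shift_zpow_apply (k : ℤ) (ω : LampGroup n p) (i : ℤ) :
    ((shift n p ^ k) ω).toAdd i = ω.toAdd (i + k) := by
  have hinv (ω : LampGroup n p) (i : ℤ) : ((shift n p)⁻¹ ω).toAdd i = ω.toAdd (i - 1) := by
    conv_rhs => rw [← (shift n p).apply_symm_apply ω]
    rw [shift_apply, sub_add_cancel]
    rfl
  induction k generalizing ω i with
  | zero => simp
  | succ k ih => rw [zpow_add_one, MulAut.mul_apply, ih, shift_apply]; ring_nf
  | pred k ih => rw [zpow_sub_one, MulAut.mul_apply, ih, hinv]; ring_nf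

theorem mem_shiftSub_iterate {H : Subgroup (LampGroup n p)} {g : LampGroup n p} (k : ℕ) :
    g ∈ (shiftSub n p)^[k] H ↔ (shift n p ^ (-(k : ℤ))) g ∈ H := by
  induction k generalizing g with
  | zero => simp
  | succ k ih =>
    rw [Function.iterate_succ_apply', shiftSub, Subgroup.mem_map_equiv, ih]
    have : (shift n p ^ (-(k : ℤ))) ((shift n p).symm g) =
        (shift n p ^ (-((k + 1 : ℕ) : ℤ))) g := by
      rw [Nat.cast_succ, neg_add, zpow_add, zpow_neg_one]
      rfl
    rw [this]

theorem continuous_shiftSub : Continuous (shiftSub n p) := by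
  rw [Subgroup.continuous_iff_isClopen]
  intro g
  have : {H | g ∈ shiftSub n p H} = {H | (shift n p ^ (-((1 : ℕ) : ℤ))) g ∈ H} :=
    Set.ext fun H => mem_shiftSub_iterate 1
  rw [this]
  exact Subgroup.isClopen_setOf_mem _

/-- The `k`-th block of length `m` of an element, translated to `[0, m)`. -/
def blockPart (n p m : ℕ) (k : ℤ) : LampGroup n p →* block n p 0 m where
  toFun g := ⟨.ofAdd (((shift n p ^ (-(k * (m : ℤ)))) g).toAdd.filter (· ∈ Set.Ico 0 (m : ℤ))),
    fun _ hi => Finsupp.filter_apply_neg _ _ hi⟩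
  map_one' := by
    apply Subtype.ext
    refine LampGroup.ext fun i => ?_
    simp [Finsupp.filter_apply]
  map_mul' g h := by
    apply Subtype.ext
    simp [toAdd_mul, Finsupp.filter_add]

theorem blockPart_apply_of_mem {m : ℕ} {k i : ℤ} (g : LampGroup n p) (hi : i ∈ Set.Ico 0 (m : ℤ)) :
    (blockPart n p m k g : LampGroup n p).toAdd i = g.toAdd (i - k * m) := by
  rw [sub_eq_add_neg, ← shift_zpow_apply]
  exact Finsupp.filter_apply_pos _ _ hi

theorem blockPart_shift_zpow {m : ℕ} (k : ℤ) (w : block n p 0 m) :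
    blockPart n p m k ((shift n p ^ (k * (m : ℤ))) (w : LampGroup n p)) = w := by
  refine Subtype.ext (LampGroup.ext fun i => ?_)
  by_cases hi : i ∈ Set.Ico 0 (m : ℤ)
  · rw [blockPart_apply_of_mem _ hi, shift_zpow_apply, sub_add_cancel]
  · rw [(blockPart n p m k _).2 i hi, w.2 i hi]

theorem blockPart_shift_zpow_of_ne {m : ℕ} {k l : ℤ} (hkl : k ≠ l) (w : block n p 0 m) :
    blockPart n p m k ((shift n p ^ (l * (m : ℤ))) (w : LampGroup n p)) = 1 := by
  refine Subtype.ext (LampGroup.ext fun i => ?_)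
  by_cases hi : i ∈ Set.Ico 0 (m : ℤ)
  · rw [blockPart_apply_of_mem _ hi, shift_zpow_apply, w.2 _ fun h => ?_]
    · rfl
    obtain ⟨h1, h2⟩ := hi
    obtain ⟨h3, h4⟩ := h
    rcases lt_or_gt_of_ne hkl with h | h <;> nlinarith
  · rw [(blockPart n p m k _).2 i hi]
    rfl

/-- The shift moves supports to the left, so coordinate `i` belongs to the block with index `-(i /
m)`. -/
theorem prod_shift_zpow_blockPart {m : ℕ} (hm : m ≠ 0) (g : LampGroup n p) :
    ∏ k ∈ g.toAdd.support.image (fun i => -(i / (m : ℤ))),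
      (shift n p ^ (k * (m : ℤ))) (blockPart n p m k g : LampGroup n p) = g := by
  have hm' : (0 : ℤ) < m := by positivity
  refine LampGroup.ext fun i => ?_
  rw [toAdd_prod, Finsupp.finsetSum_apply]
  simp only [shift_zpow_apply]
  have hterm (k : ℤ) : (blockPart n p m k g : LampGroup n p).toAdd (i + k * m) =
      if k = -(i / (m : ℤ)) then g.toAdd i else 0 := by
    split_ifs with hk
    · rw [blockPart_apply_of_mem, add_sub_cancel_right]
      have h1 := Int.emod_nonneg i hm'.ne'
      have h2 := Int.emod_lt_of_pos i hm'
      have h3 := Int.emod_add_mul_ediv i m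
      constructor <;> rw [hk] <;> linarith
    · refine (blockPart n p m k g).2 _ fun h => hk ?_
      have : (i + k * m) / m = 0 := Int.ediv_eq_zero_of_lt h.1 h.2
      rw [Int.add_mul_ediv_right _ _ hm'.ne'] at this
      linarith
  simp only [hterm, Finset.sum_ite_eq']
  split_ifs with h
  · rfl
  · by_contra hne
    exact h (Finset.mem_image_of_mem _ (Finsupp.mem_support_iff.mpr (Ne.symm hne)))

/-- The sum is direct: the projections `blockPart` kill all the other blocks, and every element is
the finite product of its parts. Measurability and equivariance of the block sum are read off from
this. -/
theorem mem_blockSum {m : ℕ} (hm : m ≠ 0) {H : ℤ → Subgroup (block n p 0 m)}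
    {g : LampGroup n p} : g ∈ blockSum n p m H ↔ ∀ k, blockPart n p m k g ∈ H k := by
  constructor
  · have : blockSum n p m H ≤ ⨅ k, (H k).comap (blockPart n p m k) := by
      refine iSup_le fun l => le_iInf fun k => ?_
      rintro _ ⟨_, ⟨w, hw, rfl⟩, rfl⟩
      change blockPart n p m k ((shift n p ^ (l * (m : ℤ))) (w : LampGroup n p)) ∈ H k
      by_cases hkl : k = l
      · rw [hkl, blockPart_shift_zpow]
        exact hw
      · rw [blockPart_shift_zpow_of_ne hkl]
        exact one_mem _
    intro hg k
    exact (Subgroup.mem_iInf.mp (this hg)) k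
  · intro h
    rw [← prod_shift_zpow_blockPart hm g]
    refine Subgroup.prod_mem _ fun k _ => Subgroup.mem_iSup_of_mem k ?_
    exact ⟨_, ⟨_, h k, rfl⟩, rfl⟩

theorem measurable_subgroupOf (K : Subgroup (LampGroup n p)) :
    Measurable fun H : Subgroup (LampGroup n p) => H.subgroupOf K :=
  Subgroup.measurable_iff_forall_mem.mpr fun g =>
    (Subgroup.isClopen_setOf_mem (g : LampGroup n p)).isOpen.measurableSet

theorem measurable_blockSum {m : ℕ} (hm : m ≠ 0) : Measurable (blockSum n p m) := by
  refine Subgroup.measurable_iff_forall_mem.mpr fun g => ?_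
  simp only [mem_blockSum hm, Set.ofPred_forall]
  refine MeasurableSet.iInter fun k => ?_
  exact (measurable_pi_apply (X := fun _ : ℤ => Subgroup (block n p 0 m)) k)
    (Subgroup.isClopen_setOf_mem (blockPart n p m k g)).isOpen.measurableSet

theorem blockSum_shift {m : ℕ} (hm : m ≠ 0) (H : ℤ → Subgroup (block n p 0 m)) :
    blockSum n p m (fun k => H (k - 1)) = (shiftSub n p)^[m] (blockSum n p m H) := by
  ext g
  rw [mem_shiftSub_iterate, mem_blockSum hm, mem_blockSum hm]
  have key (k : ℤ) : blockPart n p m k ((shift n p ^ (-(m : ℤ))) g) = blockPart n p m (k + 1) g := by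
    refine Subtype.ext (LampGroup.ext fun i => ?_)
    by_cases hi : i ∈ Set.Ico 0 (m : ℤ)
    · rw [blockPart_apply_of_mem _ hi, blockPart_apply_of_mem _ hi, shift_zpow_apply]
      ring_nf
    · rw [(blockPart n p m k _).2 i hi, (blockPart n p m (k + 1) _).2 i hi]
  simp only [key]
  exact ⟨fun h k => by simpa using h (k + 1), fun h k => by simpa using h (k - 1)⟩

variable (μ : Measure (Subgroup (LampGroup n p))) [IsProbabilityMeasure μ]

instance isProbabilityMeasure_map_subgroupOf (K : Subgroup (LampGroup n p)) :
    IsProbabilityMeasure (μ.map fun H => H.subgroupOf K) :=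
  Measure.isProbabilityMeasure_map (measurable_subgroupOf K).aemeasurable

theorem isProbabilityMeasure_blockBernoulli {m : ℕ} (hm : m ≠ 0) :
    IsProbabilityMeasure (blockBernoulli n p m μ) :=
  Measure.isProbabilityMeasure_map (measurable_blockSum hm).aemeasurable

/-- `blockSum` is a factor map from the Bernoulli shift to `τ^m`, and ergodicity passes to factors.
-/
theorem ergodic_blockBernoulli {m : ℕ} (hm : m ≠ 0) :
    Ergodic (shiftSub n p)^[m] (blockBernoulli n p m μ) :=
  MeasurePreserving.ergodic_of_ergodic_semiconj
    ⟨measurable_blockSum hm, rfl⟩ (ergodic_shift_infinitePi _) (continuous_shiftSub.measurable.iterate m)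
    (fun H => blockSum_shift hm H)

theorem ergodic_blockAverage {m : ℕ} (hm : m ≠ 0) :
    Ergodic (shiftSub n p) (blockAverage n p m μ) := by
  have := isProbabilityMeasure_blockBernoulli μ hm
  exact ergodic_average_map continuous_shiftSub.measurable hm (ergodic_blockBernoulli μ hm)

theorem isProbabilityMeasure_blockAverage {m : ℕ} (hm : m ≠ 0) :
    IsProbabilityMeasure (blockAverage n p m μ) := by
  have := isProbabilityMeasure_blockBernoulli μ hm
  exact isProbabilityMeasure_average_map continuous_shiftSub.measurable hm

theorem mem_blockSum_of_mem_block {m : ℕ} (hm : m ≠ 0) {H : ℤ → Subgroup (block n p 0 m)}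
    {w : LampGroup n p} (hw : w ∈ block n p 0 m) : w ∈ blockSum n p m H ↔ ⟨w, hw⟩ ∈ H 0 := by
  have h0 : blockPart n p m 0 w = ⟨w, hw⟩ := by
    simpa using blockPart_shift_zpow (n := n) (p := p) 0 ⟨w, hw⟩
  rw [mem_blockSum hm]
  refine ⟨fun h => h0 ▸ h 0, fun h k => ?_⟩
  by_cases hk : k = 0
  · subst hk
    rwa [h0]
  · have := blockPart_shift_zpow_of_ne hk (⟨w, hw⟩ : block n p 0 m)
    simp only [zero_mul, zpow_zero, MulAut.one_apply] at this
    rw [this]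
    exact one_mem _

variable {μ}

/-- After translation by `-k` the event only involves the component `H 0`, whose law is that of `H ∩
X^{[0,m)}`; the invariance of `μ` undoes the translation. -/
theorem map_shiftSub_blockBernoulli_agreeSet (hμ : MeasurePreserving (shiftSub n p) μ μ) {m : ℕ}
    (hm : m ≠ 0) (k : ℕ) {F : Finset (LampGroup n p)}
    (hF : ∀ g ∈ F, (shift n p ^ (-(k : ℤ))) g ∈ block n p 0 m) (H : Subgroup (LampGroup n p)) :
    ((blockBernoulli n p m μ).map (shiftSub n p)^[k]) (Subgroup.agreeSet F H) =
      μ (Subgroup.agreeSet F H) := by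
  have hC : MeasurableSet (Subgroup.agreeSet F H) :=
    (Subgroup.isClopen_agreeSet F H).isOpen.measurableSet
  have hτ : Measurable (shiftSub n p)^[k] := continuous_shiftSub.measurable.iterate k
  let C' : Set (Subgroup (block n p 0 m)) :=
    ⋂ g : F, {L | ⟨(shift n p ^ (-(k : ℤ))) g, hF g g.2⟩ ∈ L ↔ (g : LampGroup n p) ∈ H}
  have hC' : MeasurableSet C' := by
    refine MeasurableSet.iInter fun g => ?_
    have hm := (Subgroup.isClopen_setOf_mem
      (⟨(shift n p ^ (-(k : ℤ))) g, hF g g.2⟩ : block n p 0 m)).isOpen.measurableSet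
    by_cases hg : (g : LampGroup n p) ∈ H
    · simpa only [hg, iff_true] using hm
    · simp only [hg, iff_false]
      exact hm.compl
  have h1 : blockSum n p m ⁻¹' ((shiftSub n p)^[k] ⁻¹' Subgroup.agreeSet F H) =
      Function.eval 0 ⁻¹' C' := by
    ext y
    simp only [Set.mem_preimage, Subgroup.agreeSet, Set.mem_ofPred_eq, mem_shiftSub_iterate,
      C', Set.mem_iInter, Function.eval, Subtype.forall]
    exact forall₂_congr fun g hg => by rw [mem_blockSum_of_mem_block hm (hF g hg)]
  have h2 : (fun K : Subgroup (LampGroup n p) => K.subgroupOf (block n p 0 m)) ⁻¹' C' =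
      (shiftSub n p)^[k] ⁻¹' Subgroup.agreeSet F H := by
    ext K
    simp only [Set.mem_preimage, Subgroup.agreeSet, Set.mem_ofPred_eq, mem_shiftSub_iterate,
      C', Set.mem_iInter, Subtype.forall, Subgroup.mem_subgroupOf]
  rw [Measure.map_apply hτ hC, blockBernoulli, Measure.map_apply (measurable_blockSum hm) (hτ hC),
    h1, (measurePreserving_eval_infinitePi (fun _ : ℤ => μ.map fun H =>
      H.subgroupOf (block n p 0 m)) 0).measure_preimage hC'.nullMeasurableSet,
    Measure.map_apply (measurable_subgroupOf _) hC', h2,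
    (hμ.iterate k).measure_preimage hC.nullMeasurableSet]

theorem abs_blockAverage_agreeSet_sub_le (hμ : MeasurePreserving (shiftSub n p) μ μ) {m R : ℕ}
    (hm : m ≠ 0) {F : Finset (LampGroup n p)} (hF : ∀ g ∈ F, g ∈ block n p (-R) R)
    (H : Subgroup (LampGroup n p)) :
    |(blockAverage n p m μ).real (Subgroup.agreeSet F H) - μ.real (Subgroup.agreeSet F H)| ≤
      2 * R / m := by
  have := isProbabilityMeasure_blockBernoulli μ hm
  set C := Subgroup.agreeSet F H
  have hτ (k : ℕ) : Measurable (shiftSub n p)^[k] := continuous_shiftSub.measurable.iterate k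
  have hprob (k : ℕ) : IsProbabilityMeasure ((blockBernoulli n p m μ).map (shiftSub n p)^[k]) :=
    Measure.isProbabilityMeasure_map (hτ k).aemeasurable
  let a (k : ℕ) : ℝ := ((blockBernoulli n p m μ).map (shiftSub n p)^[k]).real C
  have ha : (blockAverage n p m μ).real C = (m : ℝ)⁻¹ * ∑ k ∈ Finset.range m, a k := by
    rw [blockAverage, Measure.real, Measure.smul_apply, Measure.coe_finsetSum, Finset.sum_apply,
      smul_eq_mul, ENNReal.toReal_mul, ENNReal.toReal_sum fun k _ => measure_ne_top _ _]
    simp [a, Measure.real]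
  have hdiff : (blockAverage n p m μ).real C - μ.real C =
      (∑ k ∈ Finset.range m, (a k - μ.real C)) / m := by
    rw [ha, Finset.sum_sub_distrib]
    simp only [Finset.sum_const, Finset.card_range, nsmul_eq_mul]
    field_simp
  -- Supports move from `[-R, R)` into `[k - R, k + R)`, which lies in `[0, m)` exactly when `k` is
  -- not exceptional.
  have hterm (k : ℕ) : |a k - μ.real C| ≤ if k < R ∨ m < k + R then 1 else 0 := by
    split_ifs with hk
    · exact abs_sub_le_of_nonneg_of_le measureReal_nonneg measureReal_le_one
        measureReal_nonneg measureReal_le_one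
    · have : a k = μ.real C := by
        refine congrArg ENNReal.toReal (map_shiftSub_blockBernoulli_agreeSet hμ hm k ?_ H)
        intro g hg i hi
        rw [shift_zpow_apply]
        refine hF g hg _ fun h => hi ?_
        obtain ⟨h1, h2⟩ := h
        constructor <;> omega
      simp [this]
  rw [hdiff, abs_div, Nat.abs_cast]
  gcongr
  calc |∑ k ∈ Finset.range m, (a k - μ.real C)| ≤ ∑ k ∈ Finset.range m, |a k - μ.real C| :=
        Finset.abs_sum_le_sum_abs _ _
    _ ≤ ∑ k ∈ Finset.range m, if k < R ∨ m < k + R then (1 : ℝ) else 0 :=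
        Finset.sum_le_sum fun k _ => hterm k
    _ = ((Finset.range m).filter fun k => k < R ∨ m < k + R).card := by simp
    _ ≤ (Finset.range R ∪ Finset.Ico (m - R) m).card := by
        gcongr
        intro k hk
        simp only [Finset.mem_filter, Finset.mem_range, Finset.mem_union, Finset.mem_Ico] at hk ⊢
        omega
    _ ≤ 2 * R := by
        have h1 := Finset.card_union_le (Finset.range R) (Finset.Ico (m - R) m)
        rw [Finset.card_range, Nat.card_Ico] at h1
        exact_mod_cast h1.trans (by omega)

theorem exists_forall_mem_block (F : Finset (LampGroup n p)) :
    ∃ R : ℕ, ∀ g ∈ F, g ∈ block n p (-R) R := by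
  classical
  let s : Finset ℤ := F.biUnion fun g => g.toAdd.support
  refine ⟨s.sup Int.natAbs + 1, fun g hg i hi => ?_⟩
  by_contra hne
  have his : i ∈ s := Finset.mem_biUnion.mpr ⟨g, hg, Finsupp.mem_support_iff.mpr hne⟩
  have := Finset.le_sup (f := Int.natAbs) his
  refine hi ⟨?_, ?_⟩ <;> push_cast <;> omega

theorem exists_tendsto_blockAverage {μ : ProbabilityMeasure (Subgroup (LampGroup n p))}
    (hμ : μ ∈ shiftIRS n p) :
    ∃ ν : ℕ → ProbabilityMeasure (Subgroup (LampGroup n p)),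
      (∀ m, 1 ≤ m → (ν m : Measure _) = blockAverage n p m μ ∧
        Ergodic (shiftSub n p) (ν m : Measure _)) ∧ Tendsto ν atTop (𝓝 μ) := by
  let ν (m : ℕ) : ProbabilityMeasure (Subgroup (LampGroup n p)) :=
    if hm : m ≠ 0 then ⟨blockAverage n p m μ, isProbabilityMeasure_blockAverage (μ : Measure (Subgroup (LampGroup n p))) hm⟩
    else μ
  have hν {m : ℕ} (hm : m ≠ 0) : (ν m : Measure _) = blockAverage n p m μ := by
    have : ν m = ⟨blockAverage n p m μ, _⟩ := dif_pos hm
    rw [this]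
    rfl
  refine ⟨ν, fun m hm => ⟨hν (by omega), ?_⟩, ?_⟩
  · rw [hν (by omega)]
    exact ergodic_blockAverage (μ : Measure (Subgroup (LampGroup n p))) (by omega)
  · refine Subgroup.tendsto_probabilityMeasure fun F H => ?_
    obtain ⟨R, hR⟩ := exists_forall_mem_block F
    rw [tendsto_iff_norm_sub_tendsto_zero]
    refine squeeze_zero' (Eventually.of_forall fun m => norm_nonneg _) ?_
      (tendsto_const_div_atTop_nhds_zero_nat (2 * R : ℝ))
    filter_upwards [eventually_ne_atTop 0] with m hm
    rw [hν hm]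
    exact abs_blockAverage_agreeSet_sub_le hμ hm hR H

end Lamplighter

/-! ### Finite generation off the base, and the perfect kernel. -/

namespace Lamplighter

variable {n p : ℕ}

section FiniteGeneration

open LaurentPolynomial

/-- The powers of `x^s`, as `ℤ`-linear endomorphisms. -/
def shiftZPowEnd (n p : ℕ) (s : ℤ) :
    Multiplicative ℤ →* Module.End ℤ (ℤ →₀ (Fin n → ZMod p)) where
  toFun k := ((shift n p ^ (s * k.toAdd)).toMonoidHom.toAdditive : _ →+ _).toIntLinearMap
  map_one' := by
    refine LinearMap.ext fun b => ?_
    change ((shift n p ^ (s * 0)) (Multiplicative.ofAdd b)).toAdd = b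
    rw [mul_zero, zpow_zero]
    rfl
  map_mul' k l := by
    refine LinearMap.ext fun b => ?_
    change ((shift n p ^ (s * (k.toAdd + l.toAdd))) (Multiplicative.ofAdd b)).toAdd =
      ((shift n p ^ (s * k.toAdd)) ((shift n p ^ (s * l.toAdd)) (Multiplicative.ofAdd b))).toAdd
    rw [mul_add, zpow_add, MulAut.mul_apply]

/-- The module structure over Laurent polynomials in which the variable acts as `x^s`. -/
abbrev laurentModule (n p : ℕ) (s : ℤ) : Module ℤ[T;T⁻¹] (ℤ →₀ (Fin n → ZMod p)) :=
  Module.compHom _ (AddMonoidAlgebra.lift ℤ _ ℤ (shiftZPowEnd n p s)).toRingHom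

theorem laurentModule_C_mul_T_smul (s : ℤ) (k a : ℤ) (b : ℤ →₀ (Fin n → ZMod p)) :
    letI := laurentModule n p s
    (C a * T k : ℤ[T;T⁻¹]) • b = a • ((shift n p ^ (s * k)) (Multiplicative.ofAdd b)).toAdd := by
  rw [← LaurentPolynomial.single_eq_C_mul_T]
  change (AddMonoidAlgebra.lift ℤ _ ℤ (shiftZPowEnd n p s)) (AddMonoidAlgebra.single k a) b = _
  rw [AddMonoidAlgebra.lift_single]
  rfl

/-- A subgroup invariant under the powers of `x^s`, as a submodule over Laurent polynomials. -/
def laurentSubmodule {s : ℤ} (N : Subgroup (LampGroup n p))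
    (hN : ∀ g ∈ N, ∀ k : ℤ, (shift n p ^ (s * k)) g ∈ N) :
    letI := laurentModule n p s
    Submodule ℤ[T;T⁻¹] (ℤ →₀ (Fin n → ZMod p)) :=
  letI := laurentModule n p s
  { carrier := {b | Multiplicative.ofAdd b ∈ N}
    zero_mem' := N.one_mem
    add_mem' := fun ha hb => N.mul_mem ha hb
    smul_mem' := fun r b hb => by
      induction r using LaurentPolynomial.induction_on' with
      | add r r' hr hr' =>
        rw [add_smul]
        exact N.mul_mem hr hr'
      | C_mul_T k a =>
        rw [laurentModule_C_mul_T_smul]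
        exact N.zpow_mem (hN _ hb k) a }

theorem finite_laurentModule [NeZero p] {s : ℤ} (hs : s ≠ 0) :
    letI := laurentModule n p s
    Module.Finite ℤ[T;T⁻¹] (ℤ →₀ (Fin n → ZMod p)) := by
  let := laurentModule n p s
  refine ⟨Submodule.fg_def.mpr ⟨Set.range fun q : Fin s.natAbs × (Fin n → ZMod p) =>
    Finsupp.single ((q.1 : ℕ) : ℤ) q.2, Set.finite_range _, eq_top_iff.mpr fun b _ => ?_⟩⟩
  induction b using Finsupp.induction_linear with
  | zero => exact zero_mem _
  | add b b' hb hb' => exact add_mem (hb trivial) (hb' trivial)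
  | single i c =>
    have h1 := Int.emod_nonneg i hs
    have h2 := Int.emod_lt_abs i hs
    have h3 := Int.emod_add_mul_ediv i s
    -- Division by `s`: powers of `x^s` bring every coordinate into `[0, |s|)`. As `p ≠ 0` there are
    -- finitely many lamp values `c`, so finitely many generators.
    have e : (Finsupp.single i c : ℤ →₀ (Fin n → ZMod p)) =
        (C 1 * T (-(i / s)) : ℤ[T;T⁻¹]) • Finsupp.single (i % s) c := by
      rw [laurentModule_C_mul_T_smul, one_smul]
      refine Finsupp.ext fun j => ?_
      rw [shift_zpow_apply]
      change _ = (Finsupp.single (i % s) c : ℤ →₀ (Fin n → ZMod p)) _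
      rw [Finsupp.single_apply, Finsupp.single_apply]
      refine if_congr ?_ rfl rfl
      rw [mul_neg]
      omega
    rw [e]
    refine Submodule.smul_mem _ _ (Submodule.subset_span ⟨⟨⟨(i % s).toNat, ?_⟩, c⟩, ?_⟩)
    · rw [Int.abs_eq_natAbs] at h2
      omega
    · simp [Int.toNat_of_nonneg h1]

/-- Subgroups stable under the powers of `x^s` are submodules of a finite module over the Noetherian
ring `ℤ[T;T⁻¹]`, with `T` acting as `x^s`. -/
theorem exists_finset_generating [NeZero p] {s : ℤ} (hs : s ≠ 0) {N : Subgroup (LampGroup n p)}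
    (hN : ∀ g ∈ N, ∀ k : ℤ, (shift n p ^ (s * k)) g ∈ N) :
    ∃ S : Finset (LampGroup n p), (∀ g ∈ S, g ∈ N) ∧ ∀ N' : Subgroup (LampGroup n p),
      (∀ g ∈ S, g ∈ N') → (∀ g ∈ N', ∀ k : ℤ, (shift n p ^ (s * k)) g ∈ N') → N ≤ N' := by
  let := laurentModule n p s
  have := finite_laurentModule (n := n) (p := p) hs
  have : IsNoetherianRing ℤ[T;T⁻¹] :=
    IsLocalization.isNoetherianRing (Submonoid.powers (Polynomial.X : Polynomial ℤ)) _ inferInstance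
  have : IsNoetherian ℤ[T;T⁻¹] (ℤ →₀ (Fin n → ZMod p)) := inferInstance
  obtain ⟨S, hS⟩ := this.noetherian (laurentSubmodule N hN)
  refine ⟨S.map Multiplicative.ofAdd.toEmbedding, fun g hg => ?_, fun N' hSN' hN' g hg => ?_⟩
  · obtain ⟨b, hb, rfl⟩ := Finset.mem_map.mp hg
    have : b ∈ laurentSubmodule N hN := hS ▸ Submodule.subset_span hb
    exact this
  · have hle : laurentSubmodule N hN ≤ laurentSubmodule N' hN' := by
      rw [← hS, Submodule.span_le]
      exact fun b hb => hSN' _ (Finset.mem_map.mpr ⟨b, hb, rfl⟩)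
    exact hle (x := g.toAdd) hg

end FiniteGeneration

instance instCountableLamplighterGroup : Countable (LamplighterGroup n p) := by
  have : Countable (Multiplicative ℤ) := inferInstanceAs (Countable ℤ)
  exact Countable.of_equiv _ SemidirectProduct.equivProd.symm

/-- The base is abelian, so only the `ℤ`-component of `u` acts on it. -/
theorem conj_inl (u : LamplighterGroup n p) (g : LampGroup n p) :
    u * SemidirectProduct.inl g * u⁻¹ = SemidirectProduct.inl ((shift n p ^ u.right.toAdd) g) := by
  ext1
  · simp only [SemidirectProduct.mul_left, SemidirectProduct.inv_left, SemidirectProduct.left_inl,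
      SemidirectProduct.mul_right, SemidirectProduct.right_inl, mul_one]
    rw [← MulAut.mul_apply, ← map_mul, mul_inv_cancel, map_one, MulAut.one_apply,
      mul_comm u.left, mul_inv_cancel_right]
    rfl
  · simp

/-- A subgroup of the lamplighter group that is not contained in the base is finitely generated. -/
theorem fg_of_map_rightHom_ne_bot [NeZero p] {V : Subgroup (LamplighterGroup n p)}
    (hV : V.map SemidirectProduct.rightHom ≠ ⊥) : V.FG := by
  classical
  obtain ⟨s, hs⟩ := (Subgroup.isCyclic_iff_exists_zpowers_eq_top _).mp
    (inferInstance : IsCyclic (V.map (SemidirectProduct.rightHom : LamplighterGroup n p →* _)))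
  have hs0 : s.toAdd ≠ 0 := by
    rintro h
    apply hV
    rw [← hs, show s = 1 from h, Subgroup.zpowers_one_eq_bot]
  obtain ⟨v, hv, hvs⟩ : s ∈ V.map (SemidirectProduct.rightHom : LamplighterGroup n p →* _) :=
    hs ▸ Subgroup.mem_zpowers s
  have hvk (k : ℤ) : (v ^ k).right.toAdd = s.toAdd * k := by
    have : (v ^ k).right = s ^ k := by
      rw [← hvs, ← map_zpow]
      rfl
    rw [this, toAdd_zpow, smul_eq_mul, mul_comm]
  have hinv (W : Subgroup (LamplighterGroup n p)) (hW : v ∈ W) :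
      ∀ g ∈ W.comap SemidirectProduct.inl, ∀ k : ℤ,
        (shift n p ^ (s.toAdd * k)) g ∈ W.comap SemidirectProduct.inl := by
    intro g hg k
    rw [Subgroup.mem_comap, ← hvk, ← conj_inl]
    exact W.mul_mem (W.mul_mem (W.zpow_mem hW k) hg) (W.inv_mem (W.zpow_mem hW k))
  obtain ⟨S, hSV, hS⟩ := exists_finset_generating hs0 (hinv V hv)
  -- `v` generates the projection, and its conjugates of `S` generate the intersection with the
  -- base. Any `u` in `V` is a power of `v` times an element of that intersection.
  refine ⟨insert v (S.image SemidirectProduct.inl), le_antisymm ?_ fun u hu => ?_⟩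
  · rw [Subgroup.closure_le]
    intro u hu
    simp only [Finset.coe_insert, Finset.coe_image, Set.mem_insert_iff, Set.mem_image] at hu
    rcases hu with rfl | ⟨g, hg, rfl⟩
    · exact hv
    · exact hSV g hg
  · set W := Subgroup.closure ((insert v (S.image SemidirectProduct.inl) :
      Finset (LamplighterGroup n p)) : Set (LamplighterGroup n p))
    have hvW : v ∈ W := Subgroup.subset_closure (by simp)
    have hVW := hS (W.comap SemidirectProduct.inl)
      (fun g hg => Subgroup.subset_closure (by simp [hg])) (hinv W hvW)
    obtain ⟨k, hk⟩ : u.right ∈ Subgroup.zpowers s := hs ▸ ⟨u, hu, rfl⟩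
    have hright : (v ^ (-k) * u).right = 1 := by
      rw [SemidirectProduct.mul_right, ← hk]
      have : (v ^ (-k)).right = s ^ (-k) := by
        rw [← hvs, ← map_zpow]
        rfl
      rw [this]
      simp
    have hw : SemidirectProduct.inl (v ^ (-k) * u).left = v ^ (-k) * u := by
      ext1
      · rfl
      · rw [hright, SemidirectProduct.right_inl]
    have hmem : v ^ (-k) * u ∈ W := by
      rw [← hw]
      refine hVW ?_
      rw [Subgroup.mem_comap, hw]
      exact V.mul_mem (V.zpow_mem hv _) hu
    have : u = v ^ k * (v ^ (-k) * u) := by simp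
    rw [this]
    exact W.mul_mem (W.zpow_mem hvW k) hmem

theorem countable_setOf_map_rightHom_ne_bot [NeZero p] :
    {V : Subgroup (LamplighterGroup n p) | V.map SemidirectProduct.rightHom ≠ ⊥}.Countable := by
  refine (Set.countable_range fun S : Finset (LamplighterGroup n p) =>
    Subgroup.closure (S : Set (LamplighterGroup n p))).mono fun V hV => ?_
  obtain ⟨S, hS⟩ := fg_of_map_rightHom_ne_bot hV
  exact ⟨S, hS⟩

theorem map_rightHom_eq_bot_iff {V : Subgroup (LamplighterGroup n p)} :
    V.map SemidirectProduct.rightHom = ⊥ ↔ ∀ g ∈ V, g.right = 1 := by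
  rw [Subgroup.map_eq_bot_iff]
  rfl

theorem isClosed_setOf_map_rightHom_eq_bot :
    IsClosed {V : Subgroup (LamplighterGroup n p) | V.map SemidirectProduct.rightHom = ⊥} := by
  simp only [map_rightHom_eq_bot_iff, Set.ofPred_forall]
  refine isClosed_iInter fun g => ?_
  by_cases hg : g.right = 1
  · simp [hg]
  · simp only [hg]
    convert (Subgroup.isClopen_setOf_mem g).compl.isClosed using 1
    ext V
    simp

theorem map_inl_comap_inl {V : Subgroup (LamplighterGroup n p)}
    (hV : V.map SemidirectProduct.rightHom = ⊥) :
    (V.comap SemidirectProduct.inl).map SemidirectProduct.inl = V := by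
  rw [Subgroup.map_comap_eq, SemidirectProduct.range_inl_eq_ker_rightHom, inf_eq_right]
  exact (Subgroup.map_eq_bot_iff _).mp hV

theorem map_rightHom_map_inl (H : Subgroup (LampGroup n p)) :
    (H.map SemidirectProduct.inl : Subgroup (LamplighterGroup n p)).map
      SemidirectProduct.rightHom = ⊥ := by
  rw [Subgroup.map_map, SemidirectProduct.rightHom_comp_inl, Subgroup.map_eq_bot_iff]
  simp

/-- The space of subgroups of `A_{n,p}` has no isolated point. -/
theorem exists_ne_mem_agreeSet (hn : 1 ≤ n) (hp : p ≠ 1) (F : Finset (LampGroup n p))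
    (H : Subgroup (LampGroup n p)) : ∃ H' ∈ Subgroup.agreeSet F H, H' ≠ H := by
  have : Fact (1 < p) ∨ p = 0 := by
    rcases Nat.lt_or_ge 1 p with h | h
    · exact Or.inl ⟨h⟩
    · right; omega
  have : Nontrivial (ZMod p) := by
    rcases this with h | rfl
    · infer_instance
    · exact inferInstanceAs (Nontrivial ℤ)
  obtain ⟨R, hR⟩ := exists_forall_mem_block F
  let c : Fin n → ZMod p := fun _ => 1
  have hc : c ≠ 0 := fun h => one_ne_zero (congrFun h ⟨0, hn⟩)
  let e : LampGroup n p := .ofAdd (Finsupp.single (R : ℤ) c)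
  have heR : e.toAdd (R : ℤ) = c := by simp [e]
  let B := block n p (-R) R
  have heB : e ∉ B := fun h => hc (by rw [← heR]; exact h _ (by simp))
  -- `F` does not see coordinates outside `[-R, R)`, so `H ⊓ B` and its join with `⟨e⟩` both agree
  -- with `H` on `F`. They differ, as `e ∉ B`, so at least one of them is not `H`.
  have h1 : H ⊓ B ∈ Subgroup.agreeSet F H := fun g hg => by
    simp [Subgroup.mem_inf, hR g hg, B]
  have h2 : H ⊓ B ⊔ Subgroup.zpowers e ∈ Subgroup.agreeSet F H := by
    intro g hg
    refine ⟨fun h => ?_, fun h => Subgroup.mem_sup_left ⟨h, hR g hg⟩⟩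
    obtain ⟨y, hy, z, hz, rfl⟩ := Subgroup.mem_sup.mp h
    obtain ⟨k, rfl⟩ := Subgroup.mem_zpowers_iff.mp hz
    have hkB : e ^ k ∈ B := (B.mul_mem_cancel_left hy.2).mp (hR _ hg)
    have hkc : k • c = 0 := by
      have h3 := hkB R (by simp)
      rw [toAdd_zpow, Finsupp.smul_apply, heR] at h3
      exact h3
    have : e ^ k = 1 := by
      have h4 : (e ^ k).toAdd = Finsupp.single (R : ℤ) (k • c) := by
        rw [toAdd_zpow]
        simp [e]
      rw [hkc, Finsupp.single_zero] at h4
      exact h4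
    rw [this, mul_one]
    exact hy.1
  by_cases hH : H ⊓ B = H
  · refine ⟨_, h2, fun h => heB ?_⟩
    have : e ∈ H := h ▸ Subgroup.mem_sup_right (Subgroup.mem_zpowers e)
    rw [← hH] at this
    exact this.2
  · exact ⟨_, h1, hH⟩

theorem perfect_setOf_map_rightHom_eq_bot (hn : 1 ≤ n) (hp : p ≠ 1) :
    Perfect {V : Subgroup (LamplighterGroup n p) | V.map SemidirectProduct.rightHom = ⊥} := by
  classical
  refine ⟨isClosed_setOf_map_rightHom_eq_bot, preperfect_iff_nhds.mpr fun V hV U hU => ?_⟩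
  obtain ⟨u, huU, hu, hVu⟩ := mem_nhds_iff.mp hU
  obtain ⟨F, hF⟩ := Subgroup.exists_agreeSet_subset hu hVu
  obtain ⟨H', hH', hne⟩ := exists_ne_mem_agreeSet hn hp (F.image SemidirectProduct.left)
    (V.comap SemidirectProduct.inl)
  refine ⟨H'.map SemidirectProduct.inl, ⟨huU (hF fun g hg => ?_), map_rightHom_map_inl H'⟩, ?_⟩
  · by_cases hg1 : g.right = 1
    · have hgl : g = SemidirectProduct.inl g.left := by
        ext1
        · rfl
        · exact hg1
      have := hH' g.left (Finset.mem_image_of_mem _ hg)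
      rw [Subgroup.mem_comap, ← hgl] at this
      rw [← this]
      conv_lhs => rw [hgl]
      exact Subgroup.mem_map_iff_mem SemidirectProduct.inl_injective
    · refine iff_of_false (fun h => hg1 ?_) (fun h => hg1 ?_)
      · exact map_rightHom_eq_bot_iff.mp (map_rightHom_map_inl H') g h
      · exact map_rightHom_eq_bot_iff.mp hV g h
  · intro h
    apply hne
    rw [← h, Subgroup.comap_map_eq_self_of_injective SemidirectProduct.inl_injective]

/-- If the kernel contained a subgroup with an element `g` outside the base, its part where `g` is a
member would be nonempty and perfect. It would contain an injective image of Cantor space, yet lie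
among the countably many subgroups not contained in the base. -/
theorem perfectKernel_univ_eq [NeZero p] (hn : 1 ≤ n) (hp : p ≠ 1) :
    CantorBendixson.perfectKernel (Set.univ : Set (Subgroup (LamplighterGroup n p))) =
      {V | V.map SemidirectProduct.rightHom = ⊥} := by
  refine Set.Subset.antisymm (fun V hV => ?_)
    ((perfect_setOf_map_rightHom_eq_bot hn hp).subset_perfectKernel (Set.subset_univ _))
  by_contra hne
  obtain ⟨g, hgV, hg⟩ : ∃ g ∈ V, g.right ≠ 1 := by
    by_contra! h
    exact hne (map_rightHom_eq_bot_iff.mpr h)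
  have hU := Subgroup.isClopen_setOf_mem g
  have hP := CantorBendixson.perfect_perfectKernel
    (isClosed_univ : IsClosed (Set.univ : Set (Subgroup (LamplighterGroup n p))))
  have hperf : Perfect ({W : Subgroup (LamplighterGroup n p) | g ∈ W} ∩
      CantorBendixson.perfectKernel Set.univ) :=
    ⟨hU.isClosed.inter hP.closed, hP.acc.open_inter hU.isOpen⟩
  let := TopologicalSpace.metrizableSpaceMetric (Subgroup (LamplighterGroup n p))
  obtain ⟨f, hf, _, hinj⟩ := hperf.exists_nat_bool_injection ⟨V, hgV, hV⟩
  have hcount : (Set.range f).Countable := by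
    refine countable_setOf_map_rightHom_ne_bot.mono ?_
    intro W hW hbot
    exact hg (map_rightHom_eq_bot_iff.mp hbot g (hf hW).1)
  have : Countable (ℕ → Bool) := by
    rw [Set.countable_coe_iff.symm] at hcount
    exact (Equiv.ofInjective f hinj).countable_iff.mpr hcount
  have hle := Cardinal.mk_le_aleph0 (α := ℕ → Bool)
  rw [← Cardinal.power_def, Cardinal.mk_bool, Cardinal.mk_nat] at hle
  exact (Cardinal.cantor _).not_ge hle

end Lamplighter

/-! ### Push-forward of functionals. -/

section Pushforward

variable {X Y : Type*} [TopologicalSpace X] [TopologicalSpace Y]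

/-- The push-forward of functionals on `C(X)` along a continuous map. -/
def WeakDual.pushforward (c : C(X, Y)) :
    WeakDual ℝ C(X, ℝ) →L[ℝ] WeakDual ℝ C(Y, ℝ) where
  toFun φ := StrongDual.toWeakDual
    { toFun := fun f => φ (f.comp c)
      map_add' := fun f g => map_add φ (f.comp c) (g.comp c)
      map_smul' := fun a f => map_smul φ a (f.comp c)
      cont := (ContinuousLinearMap.continuous φ).comp (ContinuousMap.continuous_precomp c) }
  map_add' _ _ := rfl
  map_smul' _ _ := rfl
  cont := WeakDual.continuous_of_continuous_eval fun f => WeakDual.eval_continuous (f.comp c)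

theorem WeakDual.pushforward_apply (c : C(X, Y)) (φ : WeakDual ℝ C(X, ℝ)) (f : C(Y, ℝ)) :
    WeakDual.pushforward c φ f = φ (f.comp c) := rfl

theorem WeakDual.leftInverse_pushforward {c : C(X, Y)} {d : C(Y, X)}
    (h : Function.LeftInverse d c) :
    Function.LeftInverse (WeakDual.pushforward d) (WeakDual.pushforward c) := by
  intro φ
  refine DFunLike.ext _ _ fun f => ?_
  rw [WeakDual.pushforward_apply, WeakDual.pushforward_apply]
  congr 1
  ext x
  exact congrArg f (h x)

theorem WeakDual.pushforward_measureToDual [CompactSpace X] [MeasurableSpace X] [BorelSpace X]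
    [CompactSpace Y] [MeasurableSpace Y] [BorelSpace Y] (c : C(X, Y)) (μ : ProbabilityMeasure X) :
    WeakDual.pushforward c (measureToDual μ) =
      measureToDual (μ.map c.continuous.measurable.aemeasurable) := by
  refine DFunLike.ext _ _ fun f => ?_
  rw [WeakDual.pushforward_apply, measureToDual_apply, measureToDual_apply]
  exact (integral_map c.continuous.measurable.aemeasurable f.continuous.aestronglyMeasurable).symm

end Pushforward

/-! ### Shift-invariant measures versus invariant random subgroups. -/

namespace Lamplighter

variable {n p : ℕ}

/-- The map induced on subgroups by the inclusion of `A_{n,p}` in the lamplighter group. -/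
def inlSub (n p : ℕ) : C(Subgroup (LampGroup n p), Subgroup (LamplighterGroup n p)) where
  toFun H := H.map SemidirectProduct.inl
  continuous_toFun := by
    rw [Subgroup.continuous_iff_isClopen]
    intro g
    by_cases hg : g.right = 1
    · have hgl : g = SemidirectProduct.inl g.left := by
        ext1
        · rfl
        · exact hg
      have : {H : Subgroup (LampGroup n p) | g ∈ H.map
          (SemidirectProduct.inl : LampGroup n p →* LamplighterGroup n p)} = {H | g.left ∈ H} := by
        ext H
        rw [Set.mem_ofPred_eq, hgl]
        exact Subgroup.mem_map_iff_mem SemidirectProduct.inl_injective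
      rw [this]
      exact Subgroup.isClopen_setOf_mem _
    · have : {H : Subgroup (LampGroup n p) | g ∈ H.map
          (SemidirectProduct.inl : LampGroup n p →* LamplighterGroup n p)} = ∅ := by
        refine Set.eq_empty_of_forall_notMem fun H hH => hg ?_
        exact map_rightHom_eq_bot_iff.mp (map_rightHom_map_inl H) g hH
      rw [this]
      exact isClopen_empty

/-- The intersection of subgroups of the lamplighter group with `A_{n,p}`. -/
def inlComap (n p : ℕ) : C(Subgroup (LamplighterGroup n p), Subgroup (LampGroup n p)) where
  toFun V := V.comap SemidirectProduct.inl
  continuous_toFun := by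
    rw [Subgroup.continuous_iff_isClopen]
    exact fun g => Subgroup.isClopen_setOf_mem (SemidirectProduct.inl g)

theorem leftInverse_inlComap_inlSub : Function.LeftInverse (inlComap n p) (inlSub n p) := fun H =>
  Subgroup.comap_map_eq_self_of_injective SemidirectProduct.inl_injective H

/-- The action of the powers of the shift on subgroups. -/
def shiftSubEquiv (n p : ℕ) (k : ℤ) : Subgroup (LampGroup n p) ≃ Subgroup (LampGroup n p) :=
  (shift n p ^ k).mapSubgroup.toEquiv

theorem mem_shiftSubEquiv {k : ℤ} {H : Subgroup (LampGroup n p)} {g : LampGroup n p} :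
    g ∈ shiftSubEquiv n p k H ↔ (shift n p ^ (-k)) g ∈ H := by
  rw [zpow_neg]
  exact Subgroup.mem_map_equiv

theorem measurable_shiftSubEquiv (k : ℤ) : Measurable (shiftSubEquiv n p k) := by
  refine Subgroup.measurable_iff_forall_mem.mpr fun g => ?_
  simp only [mem_shiftSubEquiv]
  exact (Subgroup.isClopen_setOf_mem _).isOpen.measurableSet

theorem shiftSubEquiv_natCast (k : ℕ) : ⇑(shiftSubEquiv n p k) = (shiftSub n p)^[k] := by
  funext H
  ext g
  rw [mem_shiftSubEquiv, mem_shiftSub_iterate]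

theorem shiftSubEquiv_neg (k : ℤ) (H : Subgroup (LampGroup n p)) :
    shiftSubEquiv n p (-k) (shiftSubEquiv n p k H) = H := by
  ext g
  rw [mem_shiftSubEquiv, mem_shiftSubEquiv, ← MulAut.mul_apply, ← zpow_add]
  simp

theorem preimage_shiftSubEquiv_eq {B : Set (Subgroup (LampGroup n p))}
    (hB : shiftSub n p ⁻¹' B = B) (k : ℤ) : shiftSubEquiv n p k ⁻¹' B = B := by
  have hnat (k : ℕ) : shiftSubEquiv n p k ⁻¹' B = B := by
    rw [shiftSubEquiv_natCast]
    induction k with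
    | zero => rfl
    | succ k ih => rw [Function.iterate_succ, Set.preimage_comp, ih, hB]
  obtain ⟨k, rfl | rfl⟩ := k.eq_nat_or_neg
  · exact hnat k
  · ext H
    rw [Set.mem_preimage]
    conv_lhs => rw [← hnat k]
    rw [Set.mem_preimage]
    have := shiftSubEquiv_neg (-(k : ℤ)) H
    rw [neg_neg] at this
    rw [this]

theorem measurePreserving_shiftSubEquiv {μ : Measure (Subgroup (LampGroup n p))}
    (hμ : MeasurePreserving (shiftSub n p) μ μ) (k : ℤ) :
    MeasurePreserving (shiftSubEquiv n p k) μ μ := by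
  have hnat (k : ℕ) : MeasurePreserving (shiftSubEquiv n p k) μ μ := by
    rw [shiftSubEquiv_natCast]
    exact hμ.iterate k
  obtain ⟨k, rfl | rfl⟩ := k.eq_nat_or_neg
  · exact hnat k
  · refine ⟨measurable_shiftSubEquiv _, ?_⟩
    conv_lhs => rw [← (hnat k).map_eq]
    rw [Measure.map_map (measurable_shiftSubEquiv _) (measurable_shiftSubEquiv _)]
    have : shiftSubEquiv n p (-(k : ℤ)) ∘ shiftSubEquiv n p k = id :=
      funext fun H => shiftSubEquiv_neg k H
    rw [this, Measure.map_id]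

section Conjugation

open scoped Pointwise

theorem inlComap_smul (c : ConjAct (LamplighterGroup n p))
    (V : Subgroup (LamplighterGroup n p)) :
    inlComap n p (c • V) = shiftSubEquiv n p (ConjAct.ofConjAct c).right.toAdd (inlComap n p V) := by
  ext g
  rw [mem_shiftSubEquiv]
  change SemidirectProduct.inl g ∈ c • V ↔ SemidirectProduct.inl _ ∈ V
  rw [Subgroup.mem_pointwise_smul_iff_inv_smul_mem, ConjAct.smul_def, conj_inl]
  rfl

theorem smul_inlSub (c : ConjAct (LamplighterGroup n p)) (H : Subgroup (LampGroup n p)) :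
    c • inlSub n p H = inlSub n p (shiftSubEquiv n p (ConjAct.ofConjAct c).right.toAdd H) := by
  have hbot : (c • inlSub n p H).map SemidirectProduct.rightHom = ⊥ := by
    rw [map_rightHom_eq_bot_iff]
    intro g hg
    rw [Subgroup.mem_pointwise_smul_iff_inv_smul_mem, ConjAct.smul_def] at hg
    have := map_rightHom_eq_bot_iff.mp (map_rightHom_map_inl H) _ hg
    simpa [mul_comm] using this
  have h1 := map_inl_comap_inl hbot
  have h2 := inlComap_smul c (inlSub n p H)
  rw [leftInverse_inlComap_inlSub] at h2
  rw [← h2]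
  exact h1.symm

theorem measurable_conj_smul (c : ConjAct (LamplighterGroup n p)) :
    Measurable fun V : Subgroup (LamplighterGroup n p) => c • V := by
  refine Subgroup.measurable_iff_forall_mem.mpr fun g => ?_
  simp only [Subgroup.mem_pointwise_smul_iff_inv_smul_mem]
  exact (Subgroup.isClopen_setOf_mem _).isOpen.measurableSet

theorem mem_IRS_map_inlSub {μ : ProbabilityMeasure (Subgroup (LampGroup n p))}
    (hμ : μ ∈ shiftIRS n p) :
    μ.map (inlSub n p).continuous.measurable.aemeasurable ∈ IRS (LamplighterGroup n p) := by
  refine ⟨fun c s hs => ?_⟩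
  have hι := (inlSub n p).continuous.measurable
  change (μ : Measure (Subgroup (LampGroup n p))).map (inlSub n p) _ =
    (μ : Measure (Subgroup (LampGroup n p))).map (inlSub n p) _
  rw [Measure.map_apply hι (measurable_conj_smul c hs), Measure.map_apply hι hs,
    ← (measurePreserving_shiftSubEquiv hμ (ConjAct.ofConjAct c).right.toAdd).measure_preimage
      (hι hs).nullMeasurableSet]
  congr 1
  ext H
  simp only [Set.mem_preimage, smul_inlSub]

theorem map_inlComap_mem_shiftIRS {ν : ProbabilityMeasure (Subgroup (LamplighterGroup n p))}
    (hν : ν ∈ IRS (LamplighterGroup n p)) :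
    ν.map (inlComap n p).continuous.measurable.aemeasurable ∈ shiftIRS n p := by
  have hρ := (inlComap n p).continuous.measurable
  refine ⟨continuous_shiftSub.measurable, Measure.ext fun B hB => ?_⟩
  change ((ν : Measure (Subgroup (LamplighterGroup n p))).map (inlComap n p)).map _ B =
    (ν : Measure (Subgroup (LamplighterGroup n p))).map (inlComap n p) B
  have hν' : SMulInvariantMeasure (ConjAct (LamplighterGroup n p))
    (Subgroup (LamplighterGroup n p)) (ν : Measure (Subgroup (LamplighterGroup n p))) := hν
  rw [Measure.map_apply continuous_shiftSub.measurable hB,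
    Measure.map_apply hρ (continuous_shiftSub.measurable hB), Measure.map_apply hρ hB,
    ← hν'.measure_preimage_smul (ConjAct.toConjAct (SemidirectProduct.inr (.ofAdd 1))) (hρ hB)]
  congr 1
  ext V
  simp only [Set.mem_preimage, inlComap_smul]
  change _ ↔ shiftSubEquiv n p ((1 : ℕ) : ℤ) _ ∈ B
  rw [shiftSubEquiv_natCast]
  rfl

/-- On subgroups of the base, conjugation is the action of the powers of the shift. Shift-invariant
sets lift to conjugation-invariant ones through `inlComap`; conversely, the preimage under `inlSub`
of an almost invariant set is almost shift-invariant. -/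
theorem isConjErgodic_map_inlSub_iff {μ : ProbabilityMeasure (Subgroup (LampGroup n p))}
    (hμ : μ ∈ shiftIRS n p) :
    IsConjErgodic (μ.map (inlSub n p).continuous.measurable.aemeasurable) ↔
      Ergodic (shiftSub n p) (μ : Measure (Subgroup (LampGroup n p))) := by
  have hι := (inlSub n p).continuous.measurable
  have hρ := (inlComap n p).continuous.measurable
  have hpres : MeasurePreserving (inlSub n p) (μ : Measure (Subgroup (LampGroup n p)))
      ((μ : Measure (Subgroup (LampGroup n p))).map (inlSub n p)) := ⟨hι, rfl⟩
  constructor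
  · intro h
    refine ⟨hμ, ⟨fun {B} hB hτB => ?_⟩⟩
    have h' : ErgodicSMul (ConjAct (LamplighterGroup n p)) (Subgroup (LamplighterGroup n p))
      ((μ : Measure (Subgroup (LampGroup n p))).map (inlSub n p)) := h
    have hconst := h'.aeconst_of_forall_preimage_smul_ae_eq (hρ hB) fun c => by
      refine EventuallyEq.of_eq ?_
      ext V
      change inlComap n p (c • V) ∈ B ↔ inlComap n p V ∈ B
      rw [inlComap_smul]
      exact Set.ext_iff.mp (preimage_shiftSubEquiv_eq hτB _) _
    rw [← hpres.aeconst_preimage (hρ hB).nullMeasurableSet, ← Set.preimage_comp,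
      leftInverse_inlComap_inlSub.comp_eq_id] at hconst
    exact hconst
  · intro h
    have hinv : SMulInvariantMeasure (ConjAct (LamplighterGroup n p))
      (Subgroup (LamplighterGroup n p)) ((μ : Measure (Subgroup (LampGroup n p))).map (inlSub n p)) := mem_IRS_map_inlSub hμ
    refine { hinv with aeconst_of_forall_preimage_smul_ae_eq := fun {s} hs hinv => ?_ }
    change EventuallyConst s (ae ((μ : Measure (Subgroup (LampGroup n p))).map (inlSub n p)))
    rw [← hpres.aeconst_preimage hs.nullMeasurableSet]
    refine h.quasiErgodic.aeconst_set₀ (hι hs).nullMeasurableSet ?_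
    -- Conjugation by the generator of `ℤ` is the shift itself, so this single element suffices.
    have h1 := hpres.quasiMeasurePreserving.preimage_ae_eq
      (hinv (ConjAct.toConjAct (SemidirectProduct.inr (.ofAdd 1))))
    refine EventuallyEq.trans (EventuallyEq.of_eq ?_) h1
    ext H
    change inlSub n p (shiftSub n p H) ∈ s ↔
      ConjAct.toConjAct (SemidirectProduct.inr (Multiplicative.ofAdd 1)) • inlSub n p H ∈ s
    rw [smul_inlSub]
    change _ ↔ inlSub n p (shiftSubEquiv n p ((1 : ℕ) : ℤ) _) ∈ s
    rw [shiftSubEquiv_natCast]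
    rfl

end Conjugation

theorem IRSLevel_zero_eq_IRSStar [NeZero p] (hn : 1 ≤ n) (hp : p ≠ 1) :
    IRSLevel n p 0 = IRSStar (LamplighterGroup n p) := by
  rw [IRSLevel, IRSStar, perfectKernel_univ_eq hn hp]
  simp only [Nat.cast_zero, ofAdd_zero, Subgroup.zpowers_one_eq_bot]

/-- A measure carried by subgroups of the base is recovered from its image under intersection with
the base, because `inlSub ∘ inlComap` is almost everywhere the identity. -/
theorem IRSStar_eq_image [NeZero p] (hn : 1 ≤ n) (hp : p ≠ 1) :
    IRSStar (LamplighterGroup n p) =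
      (fun μ : ProbabilityMeasure (Subgroup (LampGroup n p)) =>
        μ.map (inlSub n p).continuous.measurable.aemeasurable) '' shiftIRS n p := by
  have hι := (inlSub n p).continuous.measurable
  have hρ := (inlComap n p).continuous.measurable
  have hmeas := (isClosed_setOf_map_rightHom_eq_bot (n := n) (p := p)).measurableSet
  ext ν
  rw [IRSStar, perfectKernel_univ_eq hn hp]
  constructor
  · rintro ⟨hν, h1⟩
    refine ⟨_, map_inlComap_mem_shiftIRS hν, Subtype.ext ?_⟩
    change ((ν : Measure (Subgroup (LamplighterGroup n p))).map (inlComap n p)).map (inlSub n p) =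
      (ν : Measure (Subgroup (LamplighterGroup n p)))
    rw [Measure.map_map hι hρ]
    have hae : inlSub n p ∘ inlComap n p =ᵐ[(ν : Measure (Subgroup (LamplighterGroup n p)))] id := by
      filter_upwards [(prob_compl_eq_zero_iff hmeas).mpr h1] with V hV
      exact map_inl_comap_inl (hV)
    rw [Measure.map_congr hae, Measure.map_id]
  · rintro ⟨μ, hμ, rfl⟩
    refine ⟨mem_IRS_map_inlSub hμ, ?_⟩
    change (μ : Measure (Subgroup (LampGroup n p))).map (inlSub n p) _ = 1
    rw [Measure.map_apply hι hmeas]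
    have : inlSub n p ⁻¹' {V | V.map SemidirectProduct.rightHom = ⊥} = Set.univ :=
      Set.eq_univ_of_forall fun H => map_rightHom_map_inl H
    rw [this, measure_univ]

theorem measureToDual_image_IRSStar [NeZero p] (hn : 1 ≤ n) (hp : p ≠ 1) :
    measureToDual '' IRSStar (LamplighterGroup n p) =
      WeakDual.pushforward (inlSub n p) '' (measureToDual '' shiftIRS n p) := by
  rw [IRSStar_eq_image hn hp, Set.image_image, Set.image_image]
  simp only [WeakDual.pushforward_measureToDual]

theorem extremePoints_image_shiftIRS :
    (measureToDual '' shiftIRS n p).extremePoints ℝ = measureToDual '' {μ ∈ shiftIRS n p |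
      Ergodic (shiftSub n p) (μ : Measure (Subgroup (LampGroup n p)))} :=
  extremePoints_image_invariantMeasures (shiftSub n p)

theorem isPoulsenSimplex_shiftIRS (hn : 1 ≤ n) (hp : p ≠ 1) :
    IsPoulsenSimplex (measureToDual '' shiftIRS n p) where
  toIsSimplex := isSimplex_image_invariantMeasures ⟨shiftSub n p, continuous_shiftSub⟩
  nontrivial := by
    -- The Dirac masses at `⊤` and `⊥` are two invariant measures; they differ because the lamp
    -- group is nontrivial.
    obtain ⟨H', -, hH'⟩ := exists_ne_mem_agreeSet hn hp ∅ (⊥ : Subgroup (LampGroup n p))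
    have hbt : (⊤ : Subgroup (LampGroup n p)) ≠ ⊥ := fun h => hH' (eq_bot_iff.mpr (h ▸ le_top))
    have hmem {H : Subgroup (LampGroup n p)} (hH : shiftSub n p H = H) :
        diracProba H ∈ shiftIRS n p := by
      refine ⟨continuous_shiftSub.measurable, ?_⟩
      change (Measure.dirac H).map _ = Measure.dirac H
      rw [Measure.map_dirac' continuous_shiftSub.measurable, hH]
    refine ⟨_, ⟨_, hmem (H := ⊤) ?_, rfl⟩, _, ⟨_, hmem (H := ⊥) (Subgroup.map_bot _), rfl⟩, ?_⟩
    · exact Subgroup.map_top_of_surjective _ (shift n p).surjective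
    · refine fun h => hbt ?_
      exact injective_diracProba (measureToDual_injective h)
  dense_extremePoints := by
    rw [extremePoints_image_shiftIRS]
    rintro _ ⟨μ, hμ, rfl⟩
    obtain ⟨ν, hν, hlim⟩ := exists_tendsto_blockAverage hμ
    refine mem_closure_of_tendsto ((continuous_measureToDual.tendsto μ).comp hlim) ?_
    filter_upwards [eventually_ge_atTop 1] with m hm
    exact ⟨ν m, ⟨(hν m hm).2.toMeasurePreserving, (hν m hm).2⟩, rfl⟩

theorem extremePoints_image_IRSStar [NeZero p] (hn : 1 ≤ n) (hp : p ≠ 1) :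
    (measureToDual '' IRSStar (LamplighterGroup n p)).extremePoints ℝ =
      measureToDual '' {μ ∈ IRSStar (LamplighterGroup n p) | IsConjErgodic μ} := by
  have hext := extremePoints_image_of_injective
    (WeakDual.pushforward (inlSub n p)).toLinearMap
    (WeakDual.leftInverse_pushforward (leftInverse_inlComap_inlSub (n := n) (p := p))).injective
    (measureToDual '' shiftIRS n p)
  simp only [ContinuousLinearMap.coe_coe] at hext
  rw [measureToDual_image_IRSStar hn hp, hext, extremePoints_image_shiftIRS]
  ext φ
  constructor
  · rintro ⟨_, ⟨μ, ⟨hμ, hμe⟩, rfl⟩, rfl⟩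
    refine ⟨_, ⟨?_, (isConjErgodic_map_inlSub_iff hμ).mpr hμe⟩,
      (WeakDual.pushforward_measureToDual _ _).symm⟩
    rw [IRSStar_eq_image hn hp]
    exact ⟨μ, hμ, rfl⟩
  · rintro ⟨ν, ⟨hν, hνe⟩, rfl⟩
    rw [IRSStar_eq_image hn hp] at hν
    obtain ⟨μ, hμ, rfl⟩ := hν
    exact ⟨_, ⟨μ, ⟨hμ, (isConjErgodic_map_inlSub_iff hμ).mp hνe⟩, rfl⟩,
      WeakDual.pushforward_measureToDual _ _⟩

end Lamplighter

end

theorem theorem2 (n p : ℕ) (hn : 1 ≤ n) (hp : p.Prime) :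
    -- the simplex of shift-invariant measures on `Sub(A_{n,p})`
    IsPoulsenSimplex (measureToDual '' Lamplighter.shiftIRS n p) ∧
    (measureToDual '' Lamplighter.shiftIRS n p).extremePoints ℝ =
      measureToDual '' {μ ∈ Lamplighter.shiftIRS n p |
        Ergodic (Lamplighter.shiftSub n p) (μ : MeasureTheory.Measure _)} ∧
    (∀ μ ∈ Lamplighter.shiftIRS n p,
      ∃ ν : ℕ → MeasureTheory.ProbabilityMeasure (Subgroup (Lamplighter.LampGroup n p)),
        (∀ m, 1 ≤ m →
          (ν m : MeasureTheory.Measure _) = Lamplighter.blockAverage n p m μ ∧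
          Ergodic (Lamplighter.shiftSub n p) (ν m : MeasureTheory.Measure _)) ∧
        Filter.Tendsto ν Filter.atTop (nhds μ)) ∧
    -- the invariant random subgroups of `L_{n,p}` supported on the perfect kernel
    Lamplighter.IRSLevel n p 0 = Lamplighter.IRSStar (Lamplighter.LamplighterGroup n p) ∧
    IsPoulsenSimplex
      (measureToDual '' Lamplighter.IRSStar (Lamplighter.LamplighterGroup n p)) ∧
    (measureToDual '' Lamplighter.IRSStar (Lamplighter.LamplighterGroup n p)).extremePoints ℝ =
      measureToDual '' {μ ∈ Lamplighter.IRSStar (Lamplighter.LamplighterGroup n p) |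
        Lamplighter.IsConjErgodic μ} := by
  have hp1 : p ≠ 1 := hp.ne_one
  have : NeZero p := ⟨hp.ne_zero⟩
  refine ⟨Lamplighter.isPoulsenSimplex_shiftIRS hn hp1, Lamplighter.extremePoints_image_shiftIRS,
    fun μ hμ => Lamplighter.exists_tendsto_blockAverage hμ,
    Lamplighter.IRSLevel_zero_eq_IRSStar hn hp1, ?_, Lamplighter.extremePoints_image_IRSStar hn hp1⟩
  rw [Lamplighter.measureToDual_image_IRSStar hn hp1]
  exact (Lamplighter.isPoulsenSimplex_shiftIRS hn hp1).image _ _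
    (WeakDual.leftInverse_pushforward Lamplighter.leftInverse_inlComap_inlSub)
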